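/- Let $(W_t)_{t\ge 0}$ be a standard Wiener process, and for $t>0$ let $M_t=\sup_{0\le s\le t}W_s$ and $m_t=\inf_{0\le s\le t}W_s$. A copula of a random vector $(X_1,\dots,X_n)$ is a function $C:[0,1]^n\to[0,1]$ that vanishes when some coordinate is $0$, satisfies $C(u)=u_j$ when all coordinates other than the $j$-th are $1$, has nonnegative $C$-volume on every rectangle, and satisfies $\mathbb P(X_1\le x_1,\dots,X_n\le x_n)=C\big(\mathbb P(X_1\le x_1),\dots,\mathbb P(X_n\le x_n)\big)$ for all real $x_1,\dots,x_n$. The triples $(W_t,M_t,m_t)$, $t>0$, have a common copula $C_{W,M,m}$, which does not depend on $t$. Let $C_{W,M}(u,v)=C_{W,M,m}(u,v,1)$, $C_{W,m}(u,w)=C_{W,M,m}(u,1,w)$ and $C_{M,m}(v,w)=C_{W,M,m}(1,v,w)$ be its bivariate marginal copulas, and for a bivariate copula $C$ let \[ \rho(C)=12\int_0^1\!\!\int_0^1 C(u,v)\,du\,dv-3 \] be its Spearman rho. Then \[ \rho(C_{W,M})=\rho(C_{W,m})=2-\frac6\pi\arccos\Big(\frac{\sqrt6}{3}\Big)\approx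 0.8245, \] \[ \rho(C_{M,m})=\frac{24}{\pi}\sum_{n=0}^\infty(-1)^n\bigg(\arccos\frac{n}{\sqrt{2(n(n+1)+1)}}+\arccos\frac{n+1}{\sqrt{2(n(n+1)+1)}}-\arccos\frac{n+1}{\sqrt{2((n+1)(n+2)+1)}}-\arccos\frac{n+2}{\sqrt{2((n+1)(n+2)+1)}}\bigg)-3\approx 0.80649, \] where the series converges absolutely and the approximate values are correct to all the digits shown, by rounding (errors less than $5\cdot10^{-5}$ and $5\cdot10^{-6}$ respectively). -/

import Mathlib

open MeasureTheory ProbabilityTheory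
open scoped NNReal

noncomputable section

/-- The running maximum `M_t = sup {W_s : 0 ≤ s ≤ t}` of a process `W`. -/
def runningMax {Ω : Type*} (W : ℝ≥0 → Ω → ℝ) (t : ℝ≥0) (ω : Ω) : ℝ :=
  sSup ((fun s => W s ω) '' Set.Icc 0 t)

/-- The running minimum `m_t = inf {W_s : 0 ≤ s ≤ t}` of a process `W`. -/
def runningMin {Ω : Type*} (W : ℝ≥0 → Ω → ℝ) (t : ℝ≥0) (ω : Ω) : ℝ :=
  sInf ((fun s => W s ω) '' Set.Icc 0 t)

/-- The random triple `(W_t, M_t, m_t)`. -/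
def wienerTriple {Ω : Type*} (W : ℝ≥0 → Ω → ℝ) (t : ℝ≥0) : Fin 3 → Ω → ℝ :=
  ![W t, runningMax W t, runningMin W t]

/-- `C` is an `n`-copula: on the unit cube it has values in `[0,1]`, is grounded, has uniform
margins, and gives every rectangle with lower vertex `u` and upper vertex `v` a nonnegative
`C`-volume, the signed sum of the values of `C` at the vertices. Only the values of `C` on the
unit cube matter. -/
structure IsCopula {n : ℕ} (C : (Fin n → ℝ) → ℝ) : Prop where
  mem_unit : ∀ u ∈ Set.Icc (0 : Fin n → ℝ) 1, C u ∈ Set.Icc (0 : ℝ) 1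
  grounded : ∀ u ∈ Set.Icc (0 : Fin n → ℝ) 1, (∃ i, u i = 0) → C u = 0
  margin : ∀ u ∈ Set.Icc (0 : Fin n → ℝ) 1, ∀ j, (∀ i, i ≠ j → u i = 1) → C u = u j
  volume_nonneg : ∀ u ∈ Set.Icc (0 : Fin n → ℝ) 1, ∀ v ∈ Set.Icc (0 : Fin n → ℝ) 1, u ≤ v →
    0 ≤ ∑ S : Finset (Fin n), (-1 : ℝ) ^ S.card * C (fun i => if i ∈ S then u i else v i)

/-- `C` is a copula of the random vector `X = (X_1, …, X_n)`: the joint distribution function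
is the composition of `C` with the marginal distribution functions. -/
def IsCopulaOf {Ω : Type*} [MeasurableSpace Ω] {n : ℕ} (C : (Fin n → ℝ) → ℝ)
    (X : Fin n → Ω → ℝ) (P : Measure Ω) : Prop :=
  IsCopula C ∧ ∀ x : Fin n → ℝ,
    P.real {ω | ∀ i, X i ω ≤ x i} = C (fun i => P.real {ω | X i ω ≤ x i})

/-- Spearman's rho of a bivariate copula, `ρ(C) = 12 ∫₀¹ ∫₀¹ C(u,v) du dv - 3`. -/
def spearmanRho (C : (Fin 2 → ℝ) → ℝ) : ℝ :=
  12 * (∫ v in (0 : ℝ)..1, ∫ u in (0 : ℝ)..1, C ![u, v]) - 3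

/-- The marginal `C(u, v, 1)` of a trivariate copula; for `(W, M, m)` it is `C_{W,M}`. -/
def marginWM (C : (Fin 3 → ℝ) → ℝ) : (Fin 2 → ℝ) → ℝ := fun p => C ![p 0, p 1, 1]

/-- The marginal `C(u, 1, w)` of a trivariate copula; for `(W, M, m)` it is `C_{W,m}`. -/
def marginWm (C : (Fin 3 → ℝ) → ℝ) : (Fin 2 → ℝ) → ℝ := fun p => C ![p 0, 1, p 1]

/-- The marginal `C(1, v, w)` of a trivariate copula; for `(W, M, m)` it is `C_{M,m}`. -/
def marginMm (C : (Fin 3 → ℝ) → ℝ) : (Fin 2 → ℝ) → ℝ := fun p => C ![1, p 0, p 1]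

/-- The `n`-th bracket of `arccos` terms in the series for the max–min pair. -/
def arccosBracket (n : ℕ) : ℝ :=
  Real.arccos ((n : ℝ) / √(2 * ((n : ℝ) * (n + 1) + 1)))
    + Real.arccos (((n : ℝ) + 1) / √(2 * ((n : ℝ) * (n + 1) + 1)))
    - Real.arccos (((n : ℝ) + 1) / √(2 * (((n : ℝ) + 1) * (n + 2) + 1)))
    - Real.arccos (((n : ℝ) + 2) / √(2 * (((n : ℝ) + 1) * (n + 2) + 1)))

end

/-!
The reflection principle gives the joint laws of the end point and the maximum and, repeated at
two barriers, of the end point, the maximum and the minimum. By the probability integral transform,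
`ρ = 12 E[F(X', Y')] - 3`, where `F` is the joint distribution function of `X` and `Y`, and `X'` and
`Y'` are independent copies of them. The maximum is distributed as the absolute value of a normal
variable, so this mean is a combination of probabilities that three independent standard normal
variables form a vector in a trihedral cone. By Girard's spherical excess formula such a
probability is an affine function of the angles between the faces. For the maximum and the
minimum the number of reflections is unbounded, and the series has one cone for each.
-/

noncomputable section GaussianCones

open InnerProductGeometry WithLp
open scoped RealInnerProductSpace Real

/-- The standard normal distribution on the line. -/
abbrev stdNormal : Measure ℝ := gaussianReal 0 1

instance : NullSingletonClass stdNormal := nullSingletonClass_gaussianReal one_ne_zero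

lemma gaussianPDF_mul_gaussianPDF_polar (p : ℝ × ℝ) :
    gaussianPDF 0 1 (polarCoord.symm p).1 * gaussianPDF 0 1 (polarCoord.symm p).2
      = gaussianPDF 0 1 p.1 * gaussianPDF 0 1 0 := by
  simp only [gaussianPDF, gaussianPDFReal, polarCoord_symm_apply, NNReal.coe_one, sub_zero]
  rw [← ENNReal.ofReal_mul (by positivity), ← ENNReal.ofReal_mul (by positivity)]
  congr 1
  rw [mul_mul_mul_comm, ← Real.exp_add, mul_mul_mul_comm, ← Real.exp_add]
  congr 2
  linear_combination (-p.1 ^ 2 / 2) * Real.sin_sq_add_cos_sq p.2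

lemma stdNormal_prod_eq_mul_volume {S : Set (ℝ × ℝ)} {A : Set ℝ} (hS : MeasurableSet S)
    (hA : MeasurableSet A) (hAπ : A ⊆ Set.Ioo (-π) π)
    (h : ∀ p ∈ polarCoord.target, polarCoord.symm p ∈ S ↔ p.2 ∈ A) :
    stdNormal.prod stdNormal S = (∫⁻ r in Set.Ioi (0 : ℝ),
      ENNReal.ofReal r * (gaussianPDF 0 1 r * gaussianPDF 0 1 0)) * volume A := by
  have hm : Measurable (gaussianPDF 0 1) := measurable_gaussianPDF 0 1
  have hpolar : ∀ p ∈ polarCoord.target, ENNReal.ofReal p.1 • S.indicator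
      (fun z : ℝ × ℝ => gaussianPDF 0 1 z.1 * gaussianPDF 0 1 z.2) (polarCoord.symm p)
      = (ENNReal.ofReal p.1 * (gaussianPDF 0 1 p.1 * gaussianPDF 0 1 0)) * A.indicator 1 p.2 := by
    intro p hp
    by_cases hpA : p.2 ∈ A
    · rw [Set.indicator_of_mem ((h p hp).2 hpA), Set.indicator_of_mem hpA,
        gaussianPDF_mul_gaussianPDF_polar, Pi.one_apply, mul_one, smul_eq_mul]
    · rw [Set.indicator_of_notMem (mt (h p hp).1 hpA), Set.indicator_of_notMem hpA, smul_zero,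
        mul_zero]
  rw [stdNormal, gaussianReal_of_var_ne_zero _ one_ne_zero, prod_withDensity hm hm,
    withDensity_apply _ hS, ← lintegral_indicator hS, ← Measure.volume_eq_prod,
    ← lintegral_comp_polarCoord_symm,
    setLIntegral_congr_fun polarCoord.open_target.measurableSet hpolar, polarCoord_target,
    Measure.volume_eq_prod, ← Measure.prod_restrict, lintegral_prod_mul
      (f := fun r => ENNReal.ofReal r * (gaussianPDF 0 1 r * gaussianPDF 0 1 0)) (by fun_prop)
      (measurable_one.indicator hA).aemeasurable, lintegral_indicator_one hA,
    Measure.restrict_apply hA, Set.inter_eq_left.2 hAπ]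

lemma measureReal_stdNormal_prod_eq_volume_div {S : Set (ℝ × ℝ)} {A : Set ℝ}
    (hS : MeasurableSet S) (hA : MeasurableSet A) (hAπ : A ⊆ Set.Ioo (-π) π)
    (h : ∀ p ∈ polarCoord.target, polarCoord.symm p ∈ S ↔ p.2 ∈ A) :
    (stdNormal.prod stdNormal).real S = volume.real A / (2 * π) := by
  have htotal : (stdNormal.prod stdNormal).real Set.univ = _ := congrArg ENNReal.toReal
    (stdNormal_prod_eq_mul_volume .univ measurableSet_Ioo subset_rfl fun p hp => by
      simpa using hp.2)
  have hcone := congrArg ENNReal.toReal (stdNormal_prod_eq_mul_volume hS hA hAπ h)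
  rw [ENNReal.toReal_mul] at htotal hcone
  rw [probReal_univ, ← measureReal_def, Real.volume_real_Ioo_of_le (by linarith [Real.pi_pos]),
    sub_neg_eq_add, ← two_mul] at htotal
  rw [measureReal_def, hcone, measureReal_def, eq_div_iff (by positivity), mul_right_comm,
    ← htotal, one_mul]

lemma mem_Ioo_of_cos_pos {x : ℝ} (hl : -(3 * π / 2) ≤ x) (hr : x ≤ 3 * π / 2)
    (h : 0 < Real.cos x) : x ∈ Set.Ioo (-(π / 2)) (π / 2) := by
  refine ⟨lt_of_not_ge fun hx => ?_, lt_of_not_ge fun hx => ?_⟩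
  · have := Real.cos_nonpos_of_pi_div_two_le_of_le (x := -x) (by linarith) (by linarith)
    linarith [Real.cos_neg x]
  · linarith [Real.cos_nonpos_of_pi_div_two_le_of_le hx (by linarith)]

lemma measureReal_stdNormal_prod_sector {θ : ℝ} (h0 : 0 ≤ θ) (hπ : θ ≤ π) :
    (stdNormal.prod stdNormal).real
      {p | 0 < p.1 ∧ 0 < Real.cos θ * p.1 + Real.sin θ * p.2} = 1 / 2 - θ / (2 * π) := by
  rw [measureReal_stdNormal_prod_eq_volume_div (A := Set.Ioo (θ - π / 2) (π / 2))
    (by measurability) measurableSet_Ioo (Set.Ioo_subset_Ioo (by linarith) (by linarith)),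
    Real.volume_real_Ioo_of_le (by linarith)]
  · field_simp
    ring
  · rintro ⟨r, φ⟩ ⟨hr, hφ⟩
    have hrot : Real.cos θ * (r * Real.cos φ) + Real.sin θ * (r * Real.sin φ)
        = r * Real.cos (φ - θ) := by rw [Real.cos_sub]; ring
    simp only [polarCoord_symm_apply, Set.mem_ofPred_eq, hrot, mul_pos_iff_of_pos_left
      (show 0 < r from hr)]
    refine ⟨fun ⟨hcos, hcos'⟩ => ?_, fun ⟨hl, hu⟩ => ⟨Real.cos_pos_of_mem_Ioo
      ⟨by linarith, hu⟩, Real.cos_pos_of_mem_Ioo ⟨by linarith, by linarith⟩⟩⟩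
    have hmem := mem_Ioo_of_cos_pos (by linarith [hφ.1]) (by linarith [hφ.2]) hcos
    have hmem' := mem_Ioo_of_cos_pos (by linarith [hmem.1]) (by linarith [hmem.2]) hcos'
    exact ⟨by linarith [hmem'.1], hmem.2⟩

section InnerProductSpace

variable {E F : Type*} [NormedAddCommGroup E] [InnerProductSpace ℝ E] [FiniteDimensional ℝ E]
  [MeasurableSpace E] [BorelSpace E] [NormedAddCommGroup F] [InnerProductSpace ℝ F]
  [FiniteDimensional ℝ F] [MeasurableSpace F] [BorelSpace F]

lemma stdGaussian_real : stdGaussian ℝ = stdNormal := by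
  refine Measure.ext_of_charFun (funext fun t => ?_)
  have h : ((|t| : ℝ) : ℂ) ^ 2 = t ^ 2 := mod_cast sq_abs t
  simp [charFun_stdGaussian, charFun_gaussianReal, neg_div, h]

lemma map_toLp_prod_stdGaussian :
    ((stdGaussian E).prod (stdGaussian F)).map (toLp 2) = stdGaussian (WithLp 2 (E × F)) := by
  refine Measure.ext_of_charFun (funext fun t => ?_)
  have h : (‖t‖ : ℂ) ^ 2 = ‖(ofLp t).1‖ ^ 2 + ‖(ofLp t).2‖ ^ 2 :=
    mod_cast prod_norm_sq_eq_of_L2 t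
  rw [charFun_prod, charFun_stdGaussian, charFun_stdGaussian, charFun_stdGaussian,
    ← Complex.exp_add, h]
  congr 1
  ring

lemma charFunDual_map_inner_prodMk_stdGaussian (a b : E) (L : StrongDual ℝ (ℝ × ℝ)) :
    charFunDual ((stdGaussian E).map fun x => (⟪a, x⟫, ⟪b, x⟫)) L
      = Complex.exp (-‖L (1, 0) • a + L (0, 1) • b‖ ^ 2 / 2) := by
  have hL : L.comp ((innerSL ℝ a).prod (innerSL ℝ b))
      = innerSL ℝ (L (1, 0) • a + L (0, 1) • b) := by
    ext x
    have hx : (⟪a, x⟫, ⟪b, x⟫) = ⟪a, x⟫ • ((1, 0) : ℝ × ℝ) + ⟪b, x⟫ • (0, 1) := by simp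
    simp [hx, -Prod.smul_mk, mul_comm]
  rw [← innerSL_apply_norm (𝕜 := ℝ) (L (1, 0) • a + L (0, 1) • b), ← charFunDual_stdGaussian,
    ← hL]
  exact charFunDual_map ((innerSL ℝ a).prod (innerSL ℝ b)) L

lemma map_inner_prodMk_stdGaussian_congr {a b : E} {c d : F} (hac : ‖a‖ = ‖c‖) (hbd : ‖b‖ = ‖d‖)
    (h : ⟪a, b⟫ = ⟪c, d⟫) :
    (stdGaussian E).map (fun x => (⟪a, x⟫, ⟪b, x⟫))
      = (stdGaussian F).map (fun x => (⟪c, x⟫, ⟪d, x⟫)) := by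
  refine Measure.ext_of_charFunDual (funext fun L => ?_)
  have hnorm : ‖L (1, 0) • a + L (0, 1) • b‖ ^ 2 = ‖L (1, 0) • c + L (0, 1) • d‖ ^ 2 := by
    simp only [norm_add_sq_real, norm_smul, real_inner_smul_left, real_inner_smul_right,
      hac, hbd, h]
  rw [charFunDual_map_inner_prodMk_stdGaussian, charFunDual_map_inner_prodMk_stdGaussian]
  norm_cast
  rw [hnorm]

lemma measureReal_stdGaussian_two_halfSpaces {a b : E} (ha : a ≠ 0) (hb : b ≠ 0) :
    (stdGaussian E).real {x | 0 < ⟪a, x⟫ ∧ 0 < ⟪b, x⟫} = 1 / 2 - angle a b / (2 * π) := by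
  have hQ : MeasurableSet {q : ℝ × ℝ | 0 < q.1 ∧ 0 < q.2} := by measurability
  set θ := angle a b with hθ
  let c : WithLp 2 (ℝ × ℝ) := toLp 2 (‖a‖, 0)
  let d : WithLp 2 (ℝ × ℝ) := toLp 2 (‖b‖ * Real.cos θ, ‖b‖ * Real.sin θ)
  have hc : ‖a‖ = ‖c‖ := by simp [c]
  have hd : ‖b‖ = ‖d‖ := by
    rw [← sq_eq_sq₀ (norm_nonneg _) (norm_nonneg _), prod_norm_sq_eq_of_L2]
    change _ = ‖_ * _‖ ^ 2 + ‖_ * _‖ ^ 2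
    simp only [Real.norm_eq_abs, sq_abs]
    linear_combination -‖b‖ ^ 2 * Real.sin_sq_add_cos_sq θ
  have hcd : ⟪a, b⟫ = ⟪c, d⟫ := by
    rw [← cos_angle_mul_norm_mul_norm, prod_inner_apply]
    simp [c, d, ← hθ]
    ring
  have hplane : stdGaussian (WithLp 2 (ℝ × ℝ)) = (stdNormal.prod stdNormal).map (toLp 2) := by
    rw [← map_toLp_prod_stdGaussian, stdGaussian_real]
  have hpair : Measurable fun x => (⟪c, x⟫, ⟪d, x⟫) := by fun_prop
  calc (stdGaussian E).real {x | 0 < ⟪a, x⟫ ∧ 0 < ⟪b, x⟫}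
      = ((stdGaussian E).map fun x => (⟪a, x⟫, ⟪b, x⟫)).real {q | 0 < q.1 ∧ 0 < q.2} := by
        rw [map_measureReal_apply (by fun_prop) hQ]
        rfl
    _ = (stdNormal.prod stdNormal).real {p | 0 < ⟪c, toLp 2 p⟫ ∧ 0 < ⟪d, toLp 2 p⟫} := by
        rw [map_inner_prodMk_stdGaussian_congr hc hd hcd, hplane,
          Measure.map_map hpair (by fun_prop), map_measureReal_apply (hpair.comp (by fun_prop)) hQ]
        rfl
    _ = 1 / 2 - θ / (2 * π) := by
        rw [← measureReal_stdNormal_prod_sector (θ := θ) (angle_nonneg a b) (angle_le_pi a b)]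
        congr 1 with p
        have hdp : ⟪d, toLp 2 p⟫ = ‖b‖ * (Real.cos θ * p.1 + Real.sin θ * p.2) := by
          simp [d, prod_inner_apply]
          ring
        have hcp : ⟪c, toLp 2 p⟫ = ‖a‖ * p.1 := by simp [c, prod_inner_apply, mul_comm]
        simp only [Set.mem_ofPred_eq, hcp, hdp, mul_pos_iff_of_pos_left (norm_pos_iff.2 ha),
          mul_pos_iff_of_pos_left (norm_pos_iff.2 hb)]

lemma map_neg_stdGaussian : (stdGaussian E).map (-·) = stdGaussian E :=
  stdGaussian_map (LinearIsometryEquiv.neg ℝ)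

lemma ae_inner_ne_zero_stdGaussian {a : E} (ha : a ≠ 0) : ∀ᵐ x ∂stdGaussian E, ⟪a, x⟫ ≠ 0 := by
  have hlaw : HasGaussianLaw (innerSL ℝ a) (stdGaussian E) :=
    IsGaussian.hasGaussianLaw_id.map_fun (innerSL ℝ a)
  have hvar : Var[innerSL ℝ a; stdGaussian E].toNNReal ≠ 0 := by
    rw [variance_dual_stdGaussian, innerSL_apply_norm]
    simpa using ha
  have := nullSingletonClass_gaussianReal (μ := (stdGaussian E)[innerSL ℝ a]) hvar
  rw [← hlaw.map_eq_gaussianReal] at this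
  have h0 := measure_singleton (μ := (stdGaussian E).map (innerSL ℝ a)) 0
  rw [Measure.map_apply (by fun_prop) (measurableSet_singleton _)] at h0
  exact measure_eq_zero_iff_ae_notMem.1 h0

end InnerProductSpace

lemma two_mul_measureReal_inter_three {Ω : Type*} [MeasurableSpace Ω] {μ : Measure Ω}
    [IsProbabilityMeasure μ] {A B C : Set Ω} (hA : MeasurableSet A) (hB : MeasurableSet B)
    (hC : MeasurableSet C) (hAc : μ.real A = μ.real Aᶜ)
    (hABC : μ.real ((A \ B) \ C) = μ.real ((B ∩ C) \ A)) :
    2 * μ.real (A ∩ B ∩ C)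
      = μ.real (A ∩ B) + μ.real (A ∩ C) + μ.real (B ∩ C) - 1 / 2 := by
  have hcompl := probReal_add_probReal_compl (μ := μ) hA
  have hA_split := measureReal_inter_add_sdiff (μ := μ) (s := A) hB
  have hAB_split := measureReal_inter_add_sdiff (μ := μ) (s := A \ B) hC
  have hAC_split := measureReal_inter_add_sdiff (μ := μ) (s := A ∩ C) hB
  have hBC_split := measureReal_inter_add_sdiff (μ := μ) (s := B ∩ C) hA
  rw [show A ∩ C ∩ B = A ∩ B ∩ C by grind, show (A ∩ C) \ B = A \ B ∩ C by grind] at hAC_split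
  rw [show B ∩ C ∩ A = A ∩ B ∩ C by grind] at hBC_split
  linarith

section InnerProductSpace

variable {E : Type*} [NormedAddCommGroup E] [InnerProductSpace ℝ E] [FiniteDimensional ℝ E]
  [MeasurableSpace E] [BorelSpace E]

lemma measureReal_stdGaussian_three_halfSpaces {a b c : E} (ha : a ≠ 0) (hb : b ≠ 0)
    (hc : c ≠ 0) :
    (stdGaussian E).real {x | 0 < ⟪a, x⟫ ∧ 0 < ⟪b, x⟫ ∧ 0 < ⟪c, x⟫}
      = 1 / 2 - (angle a b + angle a c + angle b c) / (4 * π) := by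
  have hmeas : ∀ u : E, MeasurableSet {x | 0 < ⟪u, x⟫} := fun u =>
    measurableSet_lt measurable_const (by fun_prop)
  have mp : MeasurePreserving (-·) (stdGaussian E) (stdGaussian E) :=
    ⟨measurable_neg, map_neg_stdGaussian⟩
  have hAc : (stdGaussian E).real {x | 0 < ⟪a, x⟫} = (stdGaussian E).real {x | 0 < ⟪a, x⟫}ᶜ := by
    rw [← mp.measureReal_preimage (hmeas a).nullMeasurableSet]
    refine measureReal_congr ?_
    filter_upwards [ae_inner_ne_zero_stdGaussian ha] with x hx
    change (0 < ⟪a, -x⟫) = ¬ 0 < ⟪a, x⟫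
    rw [inner_neg_right]
    grind
  have hABC : (stdGaussian E).real (({x | 0 < ⟪a, x⟫} \ {x | 0 < ⟪b, x⟫}) \ {x | 0 < ⟪c, x⟫})
      = (stdGaussian E).real (({x | 0 < ⟪b, x⟫} ∩ {x | 0 < ⟪c, x⟫}) \ {x | 0 < ⟪a, x⟫}) := by
    rw [← mp.measureReal_preimage (((hmeas a).diff (hmeas b)).diff (hmeas c)).nullMeasurableSet]
    refine measureReal_congr ?_
    filter_upwards [ae_inner_ne_zero_stdGaussian ha, ae_inner_ne_zero_stdGaussian hb,
      ae_inner_ne_zero_stdGaussian hc] with x hxa hxb hxc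
    change ((0 < ⟪a, -x⟫ ∧ ¬ 0 < ⟪b, -x⟫) ∧ ¬ 0 < ⟪c, -x⟫)
      = ((0 < ⟪b, x⟫ ∧ 0 < ⟪c, x⟫) ∧ ¬ 0 < ⟪a, x⟫)
    simp only [inner_neg_right]
    grind
  have h := two_mul_measureReal_inter_three (hmeas a) (hmeas b) (hmeas c) hAc hABC
  simp only [← Set.ofPred_and, measureReal_stdGaussian_two_halfSpaces, ha, hb, hc, ne_eq,
    not_false_eq_true, and_assoc] at h
  field_simp at h ⊢
  linarith

end InnerProductSpace

/-- The standard normal distribution on space. -/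
abbrev stdNormal3 : Measure (ℝ × ℝ × ℝ) := stdNormal.prod (stdNormal.prod stdNormal)

/-- The Euclidean inner product of `ℝ × ℝ × ℝ`, whose instance norm is the supremum norm. -/
def dot3 (a p : ℝ × ℝ × ℝ) : ℝ := a.1 * p.1 + a.2.1 * p.2.1 + a.2.2 * p.2.2

lemma measureReal_stdNormal3_three_halfSpaces {a b c : ℝ × ℝ × ℝ} (ha : a ≠ 0) (hb : b ≠ 0)
    (hc : c ≠ 0) :
    stdNormal3.real {p | 0 < dot3 a p ∧ 0 < dot3 b p ∧ 0 < dot3 c p}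
      = 1 / 2 - (Real.arccos (dot3 a b / √(dot3 a a * dot3 b b))
        + Real.arccos (dot3 a c / √(dot3 a a * dot3 c c))
        + Real.arccos (dot3 b c / √(dot3 b b * dot3 c c))) / (4 * π) := by
  let f : ℝ × ℝ × ℝ → WithLp 2 (ℝ × WithLp 2 (ℝ × ℝ)) := fun p => toLp 2 (p.1, toLp 2 p.2)
  have hf : Measurable f := by fun_prop
  have hinner : ∀ x y, dot3 x y = ⟪f x, f y⟫ := fun x y => by
    simp [dot3, f, prod_inner_apply]
    ring
  have hne : ∀ x ≠ 0, f x ≠ 0 := fun x hx h => hx (by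
    simpa [f, Prod.ext_iff] using h)
  have hangle : ∀ x y, Real.arccos (dot3 x y / √(dot3 x x * dot3 y y)) = angle (f x) (f y) :=
    fun x y => by
      rw [hinner, hinner, hinner, real_inner_self_eq_norm_sq, real_inner_self_eq_norm_sq,
        ← mul_pow, Real.sqrt_sq (by positivity), angle]
  have hlaw : stdNormal3.map f = stdGaussian _ := by
    rw [← map_toLp_prod_stdGaussian, ← map_toLp_prod_stdGaussian, stdGaussian_real,
      ← (MeasurePreserving.id stdNormal).prod (⟨by fun_prop, rfl⟩ :
        MeasurePreserving (toLp 2) (stdNormal.prod stdNormal) _) |>.map_eq,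
      Measure.map_map (by fun_prop) (by fun_prop)]
    rfl
  rw [hangle, hangle, hangle, ← measureReal_stdGaussian_three_halfSpaces (hne a ha) (hne b hb)
    (hne c hc), ← hlaw, map_measureReal_apply hf]
  · simp only [hinner]
    rfl
  · measurability

end GaussianCones

noncomputable section Reflection

open Filter Topology

lemma measurable_of_denseRange {Ω T E ι : Type*} [MeasurableSpace Ω] [TopologicalSpace T]
    [FrechetUrysohnSpace T] [TopologicalSpace E] [TopologicalSpace.PseudoMetrizableSpace E]
    [MeasurableSpace E] [BorelSpace E] {q : ι → T} (hq : DenseRange q) {X : T → Ω → E}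
    (hX : ∀ ω, Continuous (X · ω)) (hm : ∀ i, Measurable (X (q i))) (t : T) :
    Measurable (X t) := by
  obtain ⟨u, hu, hut⟩ := mem_closure_iff_seq_limit.1 (hq t)
  refine measurable_of_tendsto_metrizable (f := fun n => X (u n)) (fun n => ?_)
    (tendsto_pi_nhds.2 fun ω => ((hX ω).tendsto t).comp hut)
  obtain ⟨i, hi⟩ := hu n
  exact hi ▸ hm i

/-- A Brownian motion started at zero all of whose paths are continuous and all of whose
coordinates are measurable. -/
structure IsRegularBrownian {Ω : Type*} [MeasurableSpace Ω] (W : ℝ≥0 → Ω → ℝ) (P : Measure Ω) :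
    Prop extends IsPreBrownianReal W P where
  measurable_eval : ∀ t, Measurable (W t)
  continuous_path : ∀ ω, Continuous (W · ω)
  eval_zero : ∀ ω, W 0 ω = 0

variable {Ω : Type*} {W : ℝ≥0 → Ω → ℝ}

lemma IsRegularBrownian.isProbabilityMeasure [MeasurableSpace Ω] {P : Measure Ω}
    (hW : IsRegularBrownian W P) : IsProbabilityMeasure P :=
  hW.isGaussianProcess.isProbabilityMeasure

lemma exists_isRegularBrownian [MeasurableSpace Ω] {P : Measure Ω} (hW : IsBrownianReal W P) :
    ∃ V : ℝ≥0 → Ω → ℝ, IsRegularBrownian V P ∧ ∀ᵐ ω ∂P, ∀ t, W t ω = V t ω := by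
  let q := TopologicalSpace.denseSeq ℝ≥0
  have hgood : ∀ᵐ ω ∂P, Continuous (W · ω) ∧ W 0 ω = 0 ∧
      ∀ n, W (q n) ω = (hW.aemeasurable (q n)).mk _ ω :=
    hW.cont.and (hW.eval_zero_ae_eq_zero.and
      (ae_all_iff.2 fun n => (hW.aemeasurable (q n)).ae_eq_mk))
  obtain ⟨G, hGae, hGm, hG⟩ := hgood.exists_measurable_mem
  have heq : ∀ᵐ ω ∂P, ∀ t, W t ω = G.indicator (W t) ω := by
    filter_upwards [hGae] with ω hω t
    rw [Set.indicator_of_mem hω]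
  have hcont : ∀ ω, Continuous fun t => G.indicator (W t) ω := by
    intro ω
    by_cases hω : ω ∈ G
    · simpa only [Set.indicator_of_mem hω] using (hG ω hω).1
    · simpa only [Set.indicator_of_notMem hω] using continuous_const
  have hmeas : ∀ n, Measurable (G.indicator (W (q n))) := by
    intro n
    rw [Set.indicator_congr fun ω hω => (hG ω hω).2.2 n]
    exact (hW.aemeasurable (q n)).measurable_mk.indicator hGm
  refine ⟨fun t => G.indicator (W t), ⟨hW.toIsPreBrownianReal.congr fun t => ?_,
    measurable_of_denseRange (TopologicalSpace.denseRange_denseSeq ℝ≥0) hcont hmeas, hcont,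
    fun ω => ?_⟩, heq⟩
  · filter_upwards [heq] with ω hω using hω t
  · exact Set.indicator_apply_eq_zero.2 fun hω => (hG ω hω).2.1

/-- The σ-algebra generated by a process up to time `t`. -/
abbrev pastAlgebra (W : ℝ≥0 → Ω → ℝ) (t : ℝ≥0) : MeasurableSpace Ω :=
  MeasurableSpace.comap (fun ω (s : Set.Iic t) => W s ω) inferInstance

lemma pastAlgebra_mono (W : ℝ≥0 → Ω → ℝ) {s t : ℝ≥0} (h : s ≤ t) :
    pastAlgebra W s ≤ pastAlgebra W t := by
  have hrestrict : (fun ω (r : Set.Iic s) => W r ω) =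
      (fun (x : Set.Iic t → ℝ) (r : Set.Iic s) => x ⟨r, r.2.trans h⟩) ∘
        fun ω (r : Set.Iic t) => W r ω := rfl
  rw [pastAlgebra, hrestrict, ← MeasurableSpace.comap_comp]
  exact MeasurableSpace.comap_mono (Measurable.comap_le (by fun_prop))

lemma pastAlgebra_le [mΩ : MeasurableSpace Ω] (hm : ∀ t, Measurable (W t)) (t : ℝ≥0) :
    pastAlgebra W t ≤ mΩ :=
  Measurable.comap_le (measurable_pi_lambda _ fun s => hm s)

/-- The event that a process visits `D` up to time `t`. -/
def hitSet (W : ℝ≥0 → Ω → ℝ) (D : Set ℝ) (t : ℝ≥0) : Set Ω := {ω | ∃ s ≤ t, W s ω ∈ D}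

lemma hitSet_mono (W : ℝ≥0 → Ω → ℝ) (D : Set ℝ) {s t : ℝ≥0} (h : s ≤ t) :
    hitSet W D s ⊆ hitSet W D t := fun _ ⟨r, hr, hD⟩ => ⟨r, hr.trans h, hD⟩

lemma exists_mem_iff_infDist_denseSeq {X : Type*} [TopologicalSpace X] [CompactSpace X]
    [TopologicalSpace.SeparableSpace X] [Nonempty X] {f : X → ℝ} (hf : Continuous f) {D : Set ℝ}
    (hD : IsClosed D) (hne : D.Nonempty) :
    (∃ s, f s ∈ D) ↔ ∀ n : ℕ, ∃ k,
      Metric.infDist (f (TopologicalSpace.denseSeq X k)) D < 1 / ((n : ℝ) + 1) := by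
  have hc : Continuous fun s => Metric.infDist (f s) D := (Metric.continuous_infDist_pt D).comp hf
  constructor
  · rintro ⟨s, hs⟩ n
    have ho : IsOpen {s | Metric.infDist (f s) D < 1 / ((n : ℝ) + 1)} :=
      isOpen_lt hc continuous_const
    exact (TopologicalSpace.denseRange_denseSeq X).exists_mem_open ho
      ⟨s, by simp only [Set.mem_ofPred_eq, Metric.infDist_zero_of_mem hs]; positivity⟩
  · intro h
    obtain ⟨s, -, hs⟩ := isCompact_univ.exists_isMinOn Set.univ_nonempty hc.continuousOn
    refine ⟨s, (hD.mem_iff_infDist_zero hne).2 (le_antisymm ?_ Metric.infDist_nonneg)⟩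
    refine le_of_forall_pos_le_add fun ε hε => ?_
    obtain ⟨n, hn⟩ := exists_nat_one_div_lt hε
    obtain ⟨k, hk⟩ := h n
    have := isMinOn_iff.1 hs (TopologicalSpace.denseSeq X k) trivial
    linarith

lemma measurableSet_pastAlgebra_hitSet (hc : ∀ ω, Continuous (W · ω)) {D : Set ℝ}
    (hD : IsClosed D) (hne : D.Nonempty) (t : ℝ≥0) :
    MeasurableSet[pastAlgebra W t] (hitSet W D t) := by
  have : CompactSpace (Set.Iic t) := by
    rw [← isCompact_iff_compactSpace, ← Set.Icc_bot]
    exact isCompact_Icc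
  let q := TopologicalSpace.denseSeq (Set.Iic t)
  refine ⟨⋂ n : ℕ, ⋃ k, {x | Metric.infDist (x (q k)) D < 1 / ((n : ℝ) + 1)}, ?_, ?_⟩
  · exact MeasurableSet.iInter fun n => MeasurableSet.iUnion fun k =>
      measurableSet_lt ((Metric.continuous_infDist_pt D).measurable.comp (measurable_pi_apply _))
        measurable_const
  · ext ω
    have hhit := exists_mem_iff_infDist_denseSeq (f := fun s : Set.Iic t => W s ω)
      ((hc ω).comp continuous_subtype_val) hD hne
    simp only [Set.mem_preimage, Set.mem_iInter, Set.mem_iUnion, Set.mem_ofPred_eq]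
    rw [← hhit]
    simp only [hitSet, Subtype.exists, Set.mem_Iic, exists_prop, Set.mem_ofPred_eq]

lemma IsRegularBrownian.measurableSet_hitSet [MeasurableSpace Ω] {P : Measure Ω}
    (hW : IsRegularBrownian W P) {D : Set ℝ} (hD : IsClosed D) (hne : D.Nonempty) (t : ℝ≥0) :
    MeasurableSet (hitSet W D t) :=
  pastAlgebra_le hW.measurable_eval t _
    (measurableSet_pastAlgebra_hitSet hW.continuous_path hD hne t)

/-- The first time at which a process visits `D`; it is `0` if `D` is never visited. -/
def firstHit (W : ℝ≥0 → Ω → ℝ) (D : Set ℝ) (ω : Ω) : ℝ≥0 := sInf {s | W s ω ∈ D}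

lemma firstHit_mem (hc : ∀ ω, Continuous (W · ω)) {D : Set ℝ} (hD : IsClosed D) {ω : Ω}
    {t : ℝ≥0} (h : ω ∈ hitSet W D t) : W (firstHit W D ω) ω ∈ D := by
  obtain ⟨s, -, hs⟩ := h
  exact IsClosed.csInf_mem (s := {s | W s ω ∈ D}) (hD.preimage (hc ω)) ⟨s, hs⟩ (OrderBot.bddBelow _)

lemma firstHit_le_iff (hc : ∀ ω, Continuous (W · ω)) {D : Set ℝ} (hD : IsClosed D) {ω : Ω}
    {t : ℝ≥0} (h : ω ∈ hitSet W D t) (s : ℝ≥0) : firstHit W D ω ≤ s ↔ ω ∈ hitSet W D s :=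
  ⟨fun hs => ⟨_, hs, firstHit_mem hc hD h⟩,
    fun ⟨_, hr, hD'⟩ => (csInf_le (s := {s | W s ω ∈ D}) (OrderBot.bddBelow _) hD').trans hr⟩

section FixedTime

variable [MeasurableSpace Ω] {P : Measure Ω}

lemma setIntegral_preimage_eq_of_identDistrib {E F : Type*} [MeasurableSpace E]
    [MeasurableSpace F] {ξ ξ' : Ω → E} {η : Ω → F}
    (h : IdentDistrib (fun ω => (ξ ω, η ω)) (fun ω => (ξ' ω, η ω)) P P) (hη : Measurable η)
    {S : Set F} (hS : MeasurableSet S) {f : E × F → ℝ} (hf : Measurable f) :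
    ∫ ω in η ⁻¹' S, f (ξ ω, η ω) ∂P = ∫ ω in η ⁻¹' S, f (ξ' ω, η ω) ∂P := by
  rw [← integral_indicator (hη hS), ← integral_indicator (hη hS)]
  exact (h.comp (hf.indicator (measurable_snd hS))).integral_eq

lemma IsRegularBrownian.identDistrib_increment_neg (hW : IsRegularBrownian W P) (s t : ℝ≥0) :
    IdentDistrib (W t - W s) (-(W t - W s)) P P := by
  have hlaw := hW.hasLaw_sub t s
  exact hlaw.identDistrib (by simpa only [neg_zero] using gaussianReal_neg hlaw)

lemma IsRegularBrownian.indepFun_increment_past (hW : IsRegularBrownian W P) {s t : ℝ≥0}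
    (hst : s ≤ t) : IndepFun (W t - W s) (fun ω (r : Set.Iic s) => W r ω) P := by
  have heval : Measurable fun x : ℝ≥0 → ℝ => x (t - s) := measurable_pi_apply _
  have h := (hW.indepFun_shift s).comp heval measurable_id
  convert h using 1
  · ext ω
    simp only [Pi.sub_apply, Function.comp_apply, add_tsub_cancel_of_le hst]
  · rfl

lemma IsRegularBrownian.setIntegral_reflect (hW : IsRegularBrownian W P) {s t : ℝ≥0}
    (hst : s ≤ t) {E : Set Ω} (hE : MeasurableSet[pastAlgebra W s] E) {g : ℝ → ℝ}
    (hg : Measurable g) :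
    ∫ ω in E, g (W t ω) ∂P = ∫ ω in E, g (2 * W s ω - W t ω) ∂P := by
  have := hW.isProbabilityMeasure
  obtain ⟨S, hS, rfl⟩ := hE
  have hpast : Measurable fun ω (r : Set.Iic s) => W r ω :=
    measurable_pi_lambda _ fun r => hW.measurable_eval r
  have hind := hW.indepFun_increment_past hst
  have hflip := (hW.identDistrib_increment_neg s t).prodMk (IdentDistrib.refl hpast.aemeasurable)
    hind (hind.comp measurable_neg measurable_id)
  have hf : Measurable fun p : ℝ × (Set.Iic s → ℝ) => g (p.2 ⟨s, Set.self_mem_Iic⟩ + p.1) := by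
    fun_prop
  convert setIntegral_preimage_eq_of_identDistrib hflip hpast hS hf using 4
  · simp only [Pi.sub_apply, add_sub_cancel]
  · simp only [Pi.neg_apply, Pi.sub_apply]
    ring

end FixedTime

section Grid

/-- The `j`-th point of the grid of mesh `1 / (n + 1)` on `[0, T]`, all points past the horizon `T`
being moved to `T`. -/
def gridTime (T : ℝ≥0) (n j : ℕ) : ℝ≥0 := min (j / (n + 1)) T

lemma gridTime_le (T : ℝ≥0) (n j : ℕ) : gridTime T n j ≤ T := min_le_right _ _

lemma gridTime_mono (T : ℝ≥0) (n : ℕ) : Monotone (gridTime T n) := by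
  intro i j hij
  unfold gridTime
  gcongr

variable (W) (D : Set ℝ) (T : ℝ≥0) (n : ℕ)

/-- The first hitting time of `D`, rounded up to the grid of mesh `1 / (n + 1)`, in units of
the mesh. -/
def gridHit (ω : Ω) : ℕ := ⌈((n : ℝ≥0) + 1) * firstHit W D ω⌉₊

/-- The event that `D` is visited up to time `T`, and this happens first in the `j`-th
interval of the grid. -/
def gridCell (j : ℕ) : Set Ω := hitSet W D T ∩ {ω | gridHit W D n ω = j}

/-- The end point of the path, reflected at the first visit rounded up to the grid. -/
def gridReflected (ω : Ω) : ℝ := 2 * W (gridTime T n (gridHit W D n ω)) ω - W T ω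

variable {W D T n}

lemma gridHit_le_iff (hc : ∀ ω, Continuous (W · ω)) (hD : IsClosed D) {ω : Ω}
    (h : ω ∈ hitSet W D T) (j : ℕ) :
    gridHit W D n ω ≤ j ↔ ω ∈ hitSet W D (gridTime T n j) := by
  rw [gridHit, Nat.ceil_le, ← firstHit_le_iff hc hD h, gridTime, le_min_iff,
    le_div_iff₀ (by positivity), mul_comm, and_iff_left ((firstHit_le_iff hc hD h T).2 h)]

lemma gridCell_eq (hc : ∀ ω, Continuous (W · ω)) (hD : IsClosed D) (j : ℕ) :
    gridCell W D T n j =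
      hitSet W D (gridTime T n j) \ ⋃ i ∈ Finset.range j, hitSet W D (gridTime T n i) := by
  ext ω
  simp only [gridCell, Set.mem_inter_iff, Set.mem_ofPred_eq, Set.mem_sdiff, Set.mem_iUnion,
    Finset.mem_range, not_exists]
  constructor
  · rintro ⟨hT, hj⟩
    exact ⟨(gridHit_le_iff hc hD hT j).1 hj.le, fun i hi hhit =>
      (hi.trans_eq hj.symm).not_ge ((gridHit_le_iff hc hD hT i).2 hhit)⟩
  · rintro ⟨hj, hlt⟩
    have hT := hitSet_mono W D (gridTime_le T n j) hj
    refine ⟨hT, le_antisymm ((gridHit_le_iff hc hD hT j).2 hj) (not_lt.1 fun hlt' => ?_)⟩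
    exact hlt _ hlt' ((gridHit_le_iff hc hD hT _).1 le_rfl)

lemma measurableSet_pastAlgebra_gridCell (hc : ∀ ω, Continuous (W · ω)) (hD : IsClosed D)
    (hne : D.Nonempty) (j : ℕ) :
    MeasurableSet[pastAlgebra W (gridTime T n j)] (gridCell W D T n j) := by
  rw [gridCell_eq hc hD]
  refine MeasurableSet.diff (measurableSet_pastAlgebra_hitSet hc hD hne _)
    (Finset.measurableSet_biUnion _ fun i hi => ?_)
  exact pastAlgebra_mono W (gridTime_mono T n (Finset.mem_range.1 hi).le) _
    (measurableSet_pastAlgebra_hitSet hc hD hne _)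

lemma iUnion_gridCell : ⋃ j, gridCell W D T n j = hitSet W D T := by
  ext ω
  simp [gridCell]

lemma pairwise_disjoint_gridCell : Pairwise (Function.onFun Disjoint (gridCell W D T n)) := by
  intro i j hij
  rw [Function.onFun, Set.disjoint_left]
  rintro ω ⟨-, hi⟩ ⟨-, hj⟩
  exact hij (hi.symm.trans hj)

lemma gridReflected_of_mem_gridCell {j : ℕ} {ω : Ω} (h : ω ∈ gridCell W D T n j) :
    gridReflected W D T n ω = 2 * W (gridTime T n j) ω - W T ω := by
  rw [gridReflected, h.2]

lemma tendsto_gridReflected (hc : ∀ ω, Continuous (W · ω)) (hD : IsClosed D) {ω : Ω}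
    (h : ω ∈ hitSet W D T) :
    Tendsto (fun n => gridReflected W D T n ω) atTop (𝓝 (2 * W (firstHit W D ω) ω - W T ω)) := by
  refine Tendsto.sub_const (Tendsto.const_mul 2 (((hc ω).tendsto _).comp ?_)) _
  have hround : Tendsto (fun n : ℕ => (gridHit W D n ω : ℝ≥0) / ((n : ℝ≥0) + 1)) atTop
      (𝓝 (firstHit W D ω)) := by
    rw [← NNReal.tendsto_coe]
    refine ((tendsto_nat_ceil_mul_div_atTop (firstHit W D ω).coe_nonneg).comp
      (tendsto_natCast_atTop_atTop.atTop_add (tendsto_const_nhds (x := (1 : ℝ))))).congr fun n => ?_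
    have hceil : ⌈(firstHit W D ω : ℝ) * (n + 1)⌉₊ = gridHit W D n ω := by
      rw [gridHit, mul_comm]
      exact Nonneg.nat_ceil_coe (((n : ℝ≥0) + 1) * firstHit W D ω)
    exact congrArg (fun k : ℕ => (k : ℝ) / ((n : ℝ) + 1)) hceil
  simpa only [gridTime, min_eq_left ((firstHit_le_iff hc hD h T).2 h)] using
    hround.min (tendsto_const_nhds (x := T))

variable [MeasurableSpace Ω] {P : Measure Ω}

lemma IsRegularBrownian.measurableSet_gridCell (hW : IsRegularBrownian W P) (hD : IsClosed D)
    (hne : D.Nonempty) (j : ℕ) : MeasurableSet (gridCell W D T n j) :=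
  pastAlgebra_le hW.measurable_eval _ _
    (measurableSet_pastAlgebra_gridCell hW.continuous_path hD hne j)

lemma IsRegularBrownian.aemeasurable_gridReflected (hW : IsRegularBrownian W P)
    (hD : IsClosed D) (hne : D.Nonempty) :
    AEMeasurable (gridReflected W D T n) (P.restrict (hitSet W D T)) := by
  rw [← iUnion_gridCell (n := n), aemeasurable_iUnion_iff]
  intro j
  have hj : Measurable fun ω => 2 * W (gridTime T n j) ω - W T ω :=
    ((hW.measurable_eval _).const_mul 2).sub (hW.measurable_eval T)
  refine hj.aemeasurable.congr ?_
  filter_upwards [ae_restrict_mem (hW.measurableSet_gridCell hD hne j)] with ω hω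
  exact (gridReflected_of_mem_gridCell hω).symm

lemma IsRegularBrownian.setIntegral_gridReflected (hW : IsRegularBrownian W P)
    (hD : IsClosed D) (hne : D.Nonempty) (n : ℕ) (g : BoundedContinuousFunction ℝ ℝ) :
    ∫ ω in hitSet W D T, g (gridReflected W D T n ω) ∂P = ∫ ω in hitSet W D T, g (W T ω) ∂P := by
  have := hW.isProbabilityMeasure
  have h_int : ∀ {X : Ω → ℝ}, AEMeasurable X (P.restrict (hitSet W D T)) →
      IntegrableOn (fun ω => g (X ω)) (hitSet W D T) P := fun hX =>
    Integrable.of_bound (g.continuous.measurable.comp_aemeasurable hX).aestronglyMeasurable ‖g‖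
      (ae_of_all _ fun _ => g.norm_coe_le_norm _)
  have hgrid := h_int (hW.aemeasurable_gridReflected (n := n) hD hne)
  have hend := h_int (hW.measurable_eval T).aemeasurable
  have hcell := hW.measurableSet_gridCell (T := T) (n := n) hD hne
  rw [← iUnion_gridCell (n := n)] at hgrid hend ⊢
  rw [integral_iUnion hcell pairwise_disjoint_gridCell hgrid,
    integral_iUnion hcell pairwise_disjoint_gridCell hend]
  congr 1 with j
  rw [hW.setIntegral_reflect (gridTime_le T n j)
    (measurableSet_pastAlgebra_gridCell hW.continuous_path hD hne j) g.continuous.measurable]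
  exact setIntegral_congr_fun (hcell j) fun ω hω => by simp only [gridReflected_of_mem_gridCell hω]

end Grid

section ReflectionPrinciple

variable [MeasurableSpace Ω] {P : Measure Ω} {D : Set ℝ} {T : ℝ≥0}

lemma IsRegularBrownian.ae_tendsto_gridReflected (hW : IsRegularBrownian W P) (hD : IsClosed D)
    (hne : D.Nonempty) : ∀ᵐ ω ∂P.restrict (hitSet W D T), Tendsto
      (fun n => gridReflected W D T n ω) atTop (𝓝 (2 * W (firstHit W D ω) ω - W T ω)) := by
  filter_upwards [ae_restrict_mem (hW.measurableSet_hitSet hD hne T)] with ω hω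
  exact tendsto_gridReflected hW.continuous_path hD hω

lemma IsRegularBrownian.aemeasurable_reflected (hW : IsRegularBrownian W P) (hD : IsClosed D)
    (hne : D.Nonempty) :
    AEMeasurable (fun ω => 2 * W (firstHit W D ω) ω - W T ω) (P.restrict (hitSet W D T)) :=
  aemeasurable_of_tendsto_metrizable_ae' (fun _ => hW.aemeasurable_gridReflected hD hne)
    (hW.ae_tendsto_gridReflected hD hne)

theorem IsRegularBrownian.map_restrict_hitSet_reflected (hW : IsRegularBrownian W P)
    (hD : IsClosed D) (hne : D.Nonempty) :
    (P.restrict (hitSet W D T)).map (fun ω => 2 * W (firstHit W D ω) ω - W T ω) =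
      (P.restrict (hitSet W D T)).map (W T) := by
  have := hW.isProbabilityMeasure
  have hrefl := hW.aemeasurable_reflected (T := T) hD hne
  refine ext_of_forall_integral_eq_of_IsFiniteMeasure fun g => ?_
  rw [integral_map (hW.measurable_eval T).aemeasurable g.continuous.aestronglyMeasurable,
    integral_map hrefl g.continuous.aestronglyMeasurable]
  have hlim := tendsto_integral_of_dominated_convergence (μ := P.restrict (hitSet W D T))
    (F := fun n ω => g (gridReflected W D T n ω)) (fun _ => ‖g‖)
    (fun n => (g.continuous.measurable.comp_aemeasurable
      (hW.aemeasurable_gridReflected hD hne)).aestronglyMeasurable) (integrable_const _)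
    (fun n => ae_of_all _ fun ω => g.norm_coe_le_norm _)
    ((hW.ae_tendsto_gridReflected hD hne).mono fun ω h => (g.continuous.tendsto _).comp h)
  simp_rw [hW.setIntegral_gridReflected hD hne] at hlim
  exact tendsto_nhds_unique hlim tendsto_const_nhds

theorem IsRegularBrownian.setIntegral_hitSet_eq_zero (hW : IsRegularBrownian W P)
    (hD : IsClosed D) (hne : D.Nonempty) {f : ℝ → ℝ} (hf : Measurable f)
    (hodd : ∀ b ∈ D, ∀ z, f (2 * b - z) = -f z) :
    ∫ ω in hitSet W D T, f (W T ω) ∂P = 0 := by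
  have hrefl : ∫ ω in hitSet W D T, f (W T ω) ∂P
      = ∫ ω in hitSet W D T, f (2 * W (firstHit W D ω) ω - W T ω) ∂P := by
    rw [← integral_map (hW.measurable_eval T).aemeasurable hf.aestronglyMeasurable,
      ← hW.map_restrict_hitSet_reflected hD hne,
      integral_map (hW.aemeasurable_reflected hD hne) hf.aestronglyMeasurable]
  have hneg : ∫ ω in hitSet W D T, f (2 * W (firstHit W D ω) ω - W T ω) ∂P
      = ∫ ω in hitSet W D T, -f (W T ω) ∂P :=
    setIntegral_congr_fun (hW.measurableSet_hitSet hD hne T) fun ω hω =>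
      hodd _ (firstHit_mem hW.continuous_path hD hω) _
  rw [integral_neg] at hneg
  linarith

theorem IsRegularBrownian.setIntegral_compl_hitSet (hW : IsRegularBrownian W P)
    (hD : IsClosed D) (hne : D.Nonempty) {f : ℝ → ℝ} (hf : Measurable f)
    (h_int : Integrable f (gaussianReal 0 T)) (hodd : ∀ b ∈ D, ∀ z, f (2 * b - z) = -f z) :
    ∫ ω in (hitSet W D T)ᶜ, f (W T ω) ∂P = ∫ x, f x ∂gaussianReal 0 T := by
  have hlaw := hW.hasLaw_eval T
  rw [← hlaw.map_eq] at h_int ⊢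
  rw [integral_map hlaw.aemeasurable hf.aestronglyMeasurable,
    ← integral_add_compl (f := fun ω => f (W T ω)) (hW.measurableSet_hitSet hD hne T)
      (h_int.comp_aemeasurable hlaw.aemeasurable),
    hW.setIntegral_hitSet_eq_zero hD hne hf hodd, zero_add]

end ReflectionPrinciple

section Barriers

lemma forall_ne_iff_forall_lt {w : ℝ≥0 → ℝ} (hc : Continuous w) (h0 : w 0 = 0) {y : ℝ}
    (hy : 0 < y) (T : ℝ≥0) : (∀ s ≤ T, w s ≠ y) ↔ ∀ s ≤ T, w s < y := by
  refine ⟨fun h s hs => not_le.1 fun hys => ?_, fun h s hs => (h s hs).ne⟩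
  obtain ⟨r, hr, hry⟩ := intermediate_value_Icc (zero_le : 0 ≤ s) hc.continuousOn
    ⟨h0.trans_le hy.le, hys⟩
  exact h r (hr.2.trans hs) hry

lemma forall_notMem_pair_iff_forall_mem_Ioo {w : ℝ≥0 → ℝ} (hc : Continuous w) (h0 : w 0 = 0)
    {x y : ℝ} (hx : 0 < x) (hy : 0 < y) (T : ℝ≥0) :
    (∀ s ≤ T, w s ∉ ({-x, y} : Set ℝ)) ↔ ∀ s ≤ T, w s ∈ Set.Ioo (-x) y := by
  have hup := forall_ne_iff_forall_lt hc h0 hy T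
  have hdown := forall_ne_iff_forall_lt hc.neg (by simp [h0]) hx T
  simp only [ne_eq, Pi.neg_apply, neg_eq_iff_eq_neg, neg_lt] at hup hdown
  simp only [Set.mem_insert_iff, Set.mem_singleton_iff, not_or, Set.mem_Ioo, forall_and, hup, hdown]

lemma measureReal_gaussianReal_Ici (v : ℝ≥0) (x : ℝ) :
    (gaussianReal 0 v).real (Set.Ici x) = (gaussianReal 0 v).real (Set.Iic (-x)) := by
  nth_rw 1 [← neg_zero, ← gaussianReal_map_neg]
  rw [map_measureReal_apply measurable_neg measurableSet_Ici, Set.neg_preimage, Set.neg_Ici]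

variable [MeasurableSpace Ω] {P : Measure Ω}

theorem IsRegularBrownian.measureReal_le_forall_lt (hW : IsRegularBrownian W P) (T : ℝ≥0)
    {x y : ℝ} (hy : 0 < y) (hxy : x ≤ y) :
    P.real {ω | W T ω ≤ x ∧ ∀ s ≤ T, W s ω < y}
      = (gaussianReal 0 T).real (Set.Iic x) - (gaussianReal 0 T).real (Set.Iic (x - 2 * y)) := by
  let f : ℝ → ℝ := (Set.Iic x).indicator 1 - (Set.Ici (2 * y - x)).indicator 1
  have hf : Measurable f := (measurable_one.indicator measurableSet_Iic).sub
    (measurable_one.indicator measurableSet_Ici)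
  have hIic : Integrable ((Set.Iic x).indicator (1 : ℝ → ℝ)) (gaussianReal 0 T) :=
    (integrable_const 1).indicator measurableSet_Iic
  have hIci : Integrable ((Set.Ici (2 * y - x)).indicator (1 : ℝ → ℝ)) (gaussianReal 0 T) :=
    (integrable_const 1).indicator measurableSet_Ici
  have hodd : ∀ b ∈ ({y} : Set ℝ), ∀ z, f (2 * b - z) = -f z := by
    rintro _ rfl z
    simp only [f, Pi.sub_apply, Set.indicator_apply, Pi.one_apply, Set.mem_Iic, Set.mem_Ici,
      neg_sub, sub_le_sub_iff_left, sub_le_comm]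
  have key := hW.setIntegral_compl_hitSet isClosed_singleton (Set.singleton_nonempty y) hf
    (hIic.sub hIci) hodd
  have hmem : ∀ ω, ω ∈ (hitSet W {y} T)ᶜ ↔ ∀ s ≤ T, W s ω < y := by
    intro ω
    rw [← forall_ne_iff_forall_lt (hW.continuous_path ω) (hW.eval_zero ω) hy]
    simp [hitSet]
  have hend : ∀ ω ∈ (hitSet W {y} T)ᶜ, f (W T ω) = (W T ⁻¹' Set.Iic x).indicator 1 ω := by
    intro ω hω
    have hlt := (hmem ω).1 hω T le_rfl
    have hfar : W T ω ∉ Set.Ici (2 * y - x) := by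
      rw [Set.mem_Ici]
      linarith
    simp only [f, Pi.sub_apply, Set.indicator_of_notMem hfar, sub_zero]
    rfl
  have hmx : MeasurableSet (W T ⁻¹' Set.Iic x) := hW.measurable_eval T measurableSet_Iic
  rw [setIntegral_congr_fun (hW.measurableSet_hitSet isClosed_singleton
      (Set.singleton_nonempty y) T).compl hend, integral_indicator_one hmx,
    measureReal_restrict_apply hmx, integral_sub' hIic hIci, integral_indicator_one
    measurableSet_Iic, integral_indicator_one measurableSet_Ici, measureReal_gaussianReal_Ici,
    neg_sub] at key
  rw [← key]
  congr 1 with ω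
  exact and_congr_right' (hmem ω).symm

/-- The square wave of half-period one, equal to `1` on `(0, 1)` and to `0` at the integers. -/
def squareWave (u : ℝ) : ℝ := Real.sign (Real.sin (Real.pi * u))

@[fun_prop]
lemma measurable_squareWave : Measurable squareWave := by
  have hsign : Measurable Real.sign := Measurable.ite measurableSet_Iio measurable_const
    (Measurable.ite measurableSet_Ioi measurable_const measurable_const)
  exact hsign.comp (by fun_prop)

lemma abs_squareWave_le (u : ℝ) : |squareWave u| ≤ 1 := by
  rcases Real.sign_apply_eq (Real.sin (Real.pi * u)) with h | h | h <;> simp [squareWave, h]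

lemma squareWave_neg (u : ℝ) : squareWave (-u) = -squareWave u := by
  simp only [squareWave, mul_neg, Real.sin_neg, Real.sign_neg]

lemma squareWave_add_intCast (u : ℝ) (k : ℤ) :
    squareWave (u + k) = (-1) ^ k * squareWave u := by
  rw [squareWave, mul_add, mul_comm Real.pi k, Real.sin_add_int_mul_pi, squareWave]
  rcases Int.even_or_odd k with hk | hk
  · rw [hk.neg_one_zpow, one_mul, one_mul]
  · rw [hk.neg_one_zpow, neg_one_mul, neg_one_mul, Real.sign_neg]

lemma squareWave_of_mem_Ioo {u : ℝ} (hu : u ∈ Set.Ioo 0 1) : squareWave u = 1 := by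
  have hsin : 0 < Real.sin (Real.pi * u) := Real.sin_pos_of_pos_of_lt_pi
    (mul_pos Real.pi_pos hu.1) (mul_lt_of_lt_one_right Real.pi_pos hu.2)
  rw [squareWave, Real.sign_of_pos hsin]

theorem IsRegularBrownian.measureReal_forall_mem_Ioo (hW : IsRegularBrownian W P) (T : ℝ≥0)
    {x y : ℝ} (hx : 0 < x) (hy : 0 < y) :
    P.real {ω | ∀ s ≤ T, W s ω ∈ Set.Ioo (-x) y}
      = ∫ z, squareWave ((z + x) / (x + y)) ∂gaussianReal 0 T := by
  have hL : 0 < x + y := by positivity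
  let f : ℝ → ℝ := fun z => squareWave ((z + x) / (x + y))
  have hf : Measurable f := by fun_prop
  have h_int : Integrable f (gaussianReal 0 T) :=
    Integrable.of_bound hf.aestronglyMeasurable 1 (ae_of_all _ fun _ => abs_squareWave_le _)
  have hodd : ∀ b ∈ ({-x, y} : Set ℝ), ∀ z, f (2 * b - z) = -f z := by
    rintro b (rfl | rfl) z <;> simp only [f, ← squareWave_neg]
    · congr 1
      ring
    · rw [show (2 * b - z + x) / (x + b) = -((z + x) / (x + b)) + (2 : ℤ) by
        push_cast; field_simp; ring, squareWave_add_intCast]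
      norm_num
  have hD : IsClosed ({-x, y} : Set ℝ) := (Set.toFinite _).isClosed
  have hne : ({-x, y} : Set ℝ).Nonempty := Set.insert_nonempty _ _
  have key := hW.setIntegral_compl_hitSet hD hne hf h_int hodd
  have hmem : ∀ ω, ω ∈ (hitSet W {-x, y} T)ᶜ ↔ ∀ s ≤ T, W s ω ∈ Set.Ioo (-x) y := by
    intro ω
    rw [← forall_notMem_pair_iff_forall_mem_Ioo (hW.continuous_path ω) (hW.eval_zero ω) hx hy]
    simp only [hitSet, Set.mem_compl_iff, Set.mem_ofPred_eq, not_exists, not_and]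
  have hend : ∀ ω ∈ (hitSet W {-x, y} T)ᶜ, f (W T ω) = 1 := by
    intro ω hω
    obtain ⟨hlow, hhigh⟩ := (hmem ω).1 hω T le_rfl
    exact squareWave_of_mem_Ioo ⟨div_pos (by linarith) hL, (div_lt_one hL).2 (by linarith)⟩
  rw [setIntegral_congr_fun (hW.measurableSet_hitSet hD hne T).compl hend, setIntegral_const,
    smul_eq_mul, mul_one] at key
  rw [← key]
  congr 1 with ω
  exact (hmem ω).symm

end Barriers

end Reflection

section ProbabilityIntegralTransform

open Filter Topology

variable {μ ν : Measure ℝ} [IsProbabilityMeasure μ] [IsProbabilityMeasure ν]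

lemma continuous_cdf (μ : Measure ℝ) [IsProbabilityMeasure μ] [NullSingletonClass μ] :
    Continuous (cdf μ) := by
  refine continuous_iff_continuousAt.2 fun a => ?_
  have hjump := (cdf μ).measure_singleton a
  rw [measure_cdf, measure_singleton, eq_comm, ENNReal.ofReal_eq_zero, sub_nonpos] at hjump
  rw [(monotone_cdf μ).continuousAt_iff_leftLim_eq_rightLim, (cdf μ).rightLim_eq]
  exact ((monotone_cdf μ).leftLim_le le_rfl).antisymm hjump

variable [NullSingletonClass μ] [NullSingletonClass ν]

lemma exists_cdf_eq {u : ℝ} (hu : u ∈ Set.Ioo (0 : ℝ) 1) : ∃ x, cdf μ x = u := by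
  obtain ⟨a, ha⟩ := ((tendsto_cdf_atBot μ).eventually_lt_const hu.1).exists
  obtain ⟨b, hb⟩ := ((tendsto_cdf_atTop μ).eventually_const_lt hu.2).exists
  exact mem_range_of_exists_le_of_exists_ge (continuous_cdf μ) ⟨a, ha.le⟩ ⟨b, hb.le⟩

lemma le_measureReal_cdf_le {u : ℝ} (hu : u ≤ 1) : u ≤ μ.real {x | cdf μ x ≤ u} := by
  rcases le_or_gt u 0 with h0 | h0
  · exact h0.trans measureReal_nonneg
  rcases hu.eq_or_lt with rfl | h1
  · simp only [cdf_le_one, Set.ofPred_true, probReal_univ, le_refl]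
  obtain ⟨a, rfl⟩ := exists_cdf_eq (μ := μ) ⟨h0, h1⟩
  rw [cdf_eq_real]
  exact measureReal_mono fun x hx => (cdf_eq_real μ a) ▸ monotone_cdf μ hx

lemma measureReal_cdf_lt_le {u : ℝ} (hu : 0 < u) : μ.real {x | cdf μ x < u} ≤ u := by
  rcases le_or_gt 1 u with h1 | h1
  · exact measureReal_le_one.trans h1
  obtain ⟨a, rfl⟩ := exists_cdf_eq (μ := μ) ⟨hu, h1⟩
  nth_rw 2 [cdf_eq_real]
  exact measureReal_mono fun x hx => ((monotone_cdf μ).reflect_lt hx).le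

lemma measureReal_cdf_le {u : ℝ} (hu : u ∈ Set.Icc (0 : ℝ) 1) :
    μ.real {x | cdf μ x ≤ u} = u := by
  refine le_antisymm (le_of_forall_gt_imp_ge_of_dense fun v hv => ?_) (le_measureReal_cdf_le hu.2)
  exact (measureReal_mono fun x hx => lt_of_le_of_lt hx hv).trans
    (measureReal_cdf_lt_le (hu.1.trans_lt hv))

lemma map_cdf (μ : Measure ℝ) [IsProbabilityMeasure μ] [NullSingletonClass μ] :
    μ.map (cdf μ) = volume.restrict (Set.Icc 0 1) := by
  have hm : Measurable (cdf μ) := (monotone_cdf μ).measurable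
  have := Measure.isProbabilityMeasure_map (μ := μ) hm.aemeasurable
  refine Measure.ext_of_Iic _ _ fun u => ?_
  rw [Measure.map_apply hm measurableSet_Iic, Measure.restrict_apply measurableSet_Iic]
  rcases lt_or_ge u 0 with h0 | h0
  · rw [(Set.disjoint_left.2 fun x hx hx' => (hx'.1.trans hx).not_gt h0).inter_eq, measure_empty]
    refine measure_mono_null (fun x hx => ?_) (measure_empty (μ := μ))
    exact absurd h0 ((cdf_nonneg μ x).trans hx).not_gt
  rcases le_or_gt u 1 with h1 | h1
  · rw [Set.inter_comm, ← Set.Ici_inter_Iic, Set.inter_assoc, Set.Iic_inter_Iic,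
      inf_eq_right.2 h1, Set.Ici_inter_Iic, Real.volume_Icc, sub_zero,
      ← ofReal_measureReal]
    exact congrArg ENNReal.ofReal (measureReal_cdf_le ⟨h0, h1⟩)
  · rw [Set.inter_eq_right.2 (Set.Icc_subset_Iic_self.trans (Set.Iic_subset_Iic.2 h1.le)),
      Real.volume_Icc, sub_zero, ENNReal.ofReal_one, ← measure_univ (μ := μ)]
    exact congrArg μ (Set.eq_univ_of_forall fun x => (cdf_le_one μ x).trans h1.le)

lemma intervalIntegral_eq_integral_cdf {f : ℝ → ℝ} (hf : MonotoneOn f (Set.Icc 0 1)) :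
    ∫ u in (0 : ℝ)..1, f u = ∫ x, f (cdf μ x) ∂μ := by
  have hm : AEStronglyMeasurable f (μ.map (cdf μ)) := by
    rw [map_cdf]
    exact (aemeasurable_restrict_of_monotoneOn measurableSet_Icc hf).aestronglyMeasurable
  rw [intervalIntegral.integral_of_le zero_le_one, ← integral_Icc_eq_integral_Ioc, ← map_cdf μ,
    integral_map (monotone_cdf μ).measurable.aemeasurable hm]

lemma spearmanRho_eq_integral_cdf {D : (Fin 2 → ℝ) → ℝ} (hD : MonotoneOn D (Set.Icc 0 1)) :
    spearmanRho D = 12 * (∫ y, ∫ x, D ![cdf μ x, cdf ν y] ∂μ ∂ν) - 3 := by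
  have hvec {a b : ℝ} (ha : a ∈ Set.Icc (0 : ℝ) 1) (hb : b ∈ Set.Icc (0 : ℝ) 1) :
      (![a, b] : Fin 2 → ℝ) ∈ Set.Icc (0 : Fin 2 → ℝ) 1 :=
    ⟨fun i => by fin_cases i <;> simp [ha.1, hb.1], fun i => by fin_cases i <;> simp [ha.2, hb.2]⟩
  have hfst {v : ℝ} (hv : v ∈ Set.Icc (0 : ℝ) 1) :
      MonotoneOn (fun u => D ![u, v]) (Set.Icc 0 1) := fun a ha b hb hab =>
    hD (hvec ha hv) (hvec hb hv) fun i => by fin_cases i <;> simp [hab]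
  have hsnd : MonotoneOn (fun v => ∫ u in (0 : ℝ)..1, D ![u, v]) (Set.Icc 0 1) := by
    intro a ha b hb hab
    have h_int {v : ℝ} (hv : v ∈ Set.Icc (0 : ℝ) 1) :
        IntervalIntegrable (fun u => D ![u, v]) volume 0 1 :=
      MonotoneOn.intervalIntegrable (by rw [Set.uIcc_of_le zero_le_one]; exact hfst hv)
    exact intervalIntegral.integral_mono_on zero_le_one (h_int ha) (h_int hb) fun u hu =>
      hD (hvec hu ha) (hvec hu hb) fun i => by fin_cases i <;> simp [hab]
  rw [spearmanRho, intervalIntegral_eq_integral_cdf (μ := ν) hsnd]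
  simp_rw [fun y => intervalIntegral_eq_integral_cdf (μ := μ)
    (hfst ⟨cdf_nonneg ν y, cdf_le_one ν y⟩)]

end ProbabilityIntegralTransform

section CopulaMonotone

lemma monotoneOn_Icc_of_update {ι β : Type*} [Finite ι] [DecidableEq ι] {α : ι → Type*}
    [∀ i, Preorder (α i)] [Preorder β] {a b : ∀ i, α i} {f : (∀ i, α i) → β}
    (hf : ∀ v ∈ Set.Icc a b, ∀ k, ∀ x ∈ Set.Icc (a k) (v k), f (Function.update v k x) ≤ f v) :
    MonotoneOn f (Set.Icc a b) := by
  have := Fintype.ofFinite ι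
  intro u hu v hv huv
  have hstep (s : Finset ι) : f (s.piecewise u v) ≤ f v := by
    induction s using Finset.induction_on with
    | empty => simp only [Finset.piecewise_empty, le_refl]
    | insert k s hk ih =>
      rw [Finset.piecewise_insert]
      refine (hf _ ⟨?_, ?_⟩ k (u k) ⟨hu.1 k, ?_⟩).trans ih
      · exact Finset.le_piecewise_of_le_of_le s hu.1 hv.1
      · exact Finset.piecewise_le_of_le_of_le s hu.2 hv.2
      · rw [Finset.piecewise_eq_of_notMem _ _ _ hk]
        exact huv k
  simpa only [Finset.piecewise_univ] using hstep Finset.univ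

variable {n : ℕ} {C : (Fin n → ℝ) → ℝ} {u v : Fin n → ℝ}

/- Lowering the coordinates outside `s` of the lower vertex to `0` kills, by groundedness, the
vertices indexed by the sets not contained in `s`. -/
lemma IsCopula.sum_powerset_nonneg (hC : IsCopula C) (s : Finset (Fin n)) (h0 : 0 ≤ u)
    (huv : u ≤ v) (h1 : v ≤ 1) :
    0 ≤ ∑ S ∈ s.powerset, (-1 : ℝ) ^ S.card * C (S.piecewise u v) := by
  set w : Fin n → ℝ := s.piecewise u 0
  have hw0 : 0 ≤ w := Finset.le_piecewise_of_le_of_le s h0 le_rfl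
  have hwv : w ≤ v := Finset.piecewise_le_of_le_of_le s huv (h0.trans huv)
  refine (hC.volume_nonneg w ⟨hw0, hwv.trans h1⟩ v ⟨hw0.trans hwv, h1⟩ hwv).trans_eq ?_
  rw [← Finset.sum_subset (Finset.subset_univ s.powerset)]
  · refine Finset.sum_congr rfl fun S hS => ?_
    congr 2
    ext i
    split_ifs with hi
    · rw [Finset.piecewise_eq_of_mem _ _ _ hi]
      exact Finset.piecewise_eq_of_mem _ _ _ (Finset.mem_powerset.1 hS hi)
    · exact (Finset.piecewise_eq_of_notMem _ _ _ hi).symm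
  · intro S _ hS
    obtain ⟨i, hiS, his⟩ := Finset.not_subset.1 (mt Finset.mem_powerset.2 hS)
    rw [hC.grounded _ ⟨fun k => ?_, fun k => ?_⟩
      ⟨i, by rw [if_pos hiS]; exact Finset.piecewise_eq_of_notMem _ _ _ his⟩, mul_zero]
    · dsimp only
      split_ifs
      exacts [hw0 k, (hw0.trans hwv) k]
    · dsimp only
      split_ifs
      exacts [(hwv.trans h1) k, h1 k]

lemma IsCopula.apply_update_le (hC : IsCopula C) (hv : v ∈ Set.Icc (0 : Fin n → ℝ) 1)
    {k : Fin n} {x : ℝ} (hx : x ∈ Set.Icc 0 (v k)) : C (Function.update v k x) ≤ C v := by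
  have h := hC.sum_powerset_nonneg (insert k ∅) (le_update_iff.2 ⟨hx.1, fun i _ => hv.1 i⟩)
    (update_le_iff.2 ⟨hx.2, fun _ _ => le_rfl⟩) hv.2
  rw [Finset.sum_powerset_insert (Finset.notMem_empty k)] at h
  simp only [Finset.powerset_empty, Finset.sum_singleton, Finset.card_empty, pow_zero,
    Finset.piecewise_empty, one_mul, Finset.piecewise_insert, Function.update_self,
    insert_empty_eq, Finset.card_singleton, pow_one, neg_mul] at h
  linarith

lemma IsCopula.apply_update_sub_le (hC : IsCopula C) (hv : v ∈ Set.Icc (0 : Fin n → ℝ) 1)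
    {j k : Fin n} (hjk : j ≠ k) {x y : ℝ} (hx : x ∈ Set.Icc 0 (v j)) (hy : y ∈ Set.Icc 0 (v k)) :
    C (Function.update v k y) - C (Function.update (Function.update v k y) j x) ≤
      C v - C (Function.update v j x) := by
  have h0 : 0 ≤ Function.update v k y := le_update_iff.2 ⟨hy.1, fun i _ => hv.1 i⟩
  have hle : Function.update v k y ≤ v := update_le_iff.2 ⟨hy.2, fun _ _ => le_rfl⟩
  have hj : j ∉ insert k (∅ : Finset (Fin n)) := by simpa using hjk
  have h := hC.sum_powerset_nonneg (insert j (insert k ∅))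
    (le_update_iff.2 ⟨hx.1, fun i _ => h0 i⟩) (update_le_iff.2 ⟨hx.2, fun i _ => hle i⟩) hv.2
  rw [Finset.sum_powerset_insert hj, Finset.sum_powerset_insert (Finset.notMem_empty k),
    Finset.sum_powerset_insert (Finset.notMem_empty k)] at h
  simp only [Finset.powerset_empty, Finset.sum_singleton, Finset.card_empty, pow_zero,
    Finset.piecewise_empty, one_mul, Finset.piecewise_insert, ne_eq, hjk.symm, not_false_eq_true,
    Function.update_of_ne, Function.update_self, insert_empty_eq, Finset.card_singleton, pow_one,
    neg_mul, Finset.mem_singleton, hjk, Finset.card_insert_of_notMem, Nat.reduceAdd, even_two,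
    Even.neg_pow, one_pow] at h
  linarith

lemma IsCopula.monotoneOn (hC : IsCopula C) : MonotoneOn C (Set.Icc 0 1) :=
  monotoneOn_Icc_of_update fun _ hv _ _ hx => hC.apply_update_le hv hx

lemma IsCopula.apply_update_one_sub_le (hC : IsCopula C) (hu : u ∈ Set.Icc (0 : Fin n → ℝ) 1)
    (j : Fin n) : C (Function.update u j 1) - C u ≤ 1 - u j := by
  have hmem {v : Fin n → ℝ} (hv : v ∈ Set.Icc (0 : Fin n → ℝ) 1) {x : ℝ}
      (hx : x ∈ Set.Icc (0 : ℝ) 1) : Function.update v j x ∈ Set.Icc (0 : Fin n → ℝ) 1 :=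
    ⟨le_update_iff.2 ⟨hx.1, fun i _ => hv.1 i⟩, update_le_iff.2 ⟨hx.2, fun i _ => hv.2 i⟩⟩
  have hone : (1 : Fin n → ℝ) ∈ Set.Icc (0 : Fin n → ℝ) 1 := ⟨zero_le_one, le_rfl⟩
  have hmono : MonotoneOn (fun v => C (Function.update v j 1) - C (Function.update v j (u j)))
      (Set.Icc 0 1) := by
    refine monotoneOn_Icc_of_update fun v hv k y hy => ?_
    rcases eq_or_ne j k with rfl | hjk
    · simp only [Function.update_idem, le_refl]
    · have h := hC.apply_update_sub_le (hmem hv (x := 1) ⟨zero_le_one, le_rfl⟩) hjk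
        (x := u j) (y := y) (by simpa using ⟨hu.1 j, hu.2 j⟩) (by simpa [hjk.symm] using hy)
      simpa only [Function.update_comm hjk, Function.update_idem] using h
  have h := hmono hu hone hu.2
  have hmargin {x : ℝ} (hx : x ∈ Set.Icc (0 : ℝ) 1) : C (Function.update 1 j x) = x := by
    rw [hC.margin _ (hmem hone hx) j fun i hi => Function.update_of_ne hi _ _,
      Function.update_self]
  simpa only [Function.update_eq_self, hmargin ⟨zero_le_one, le_rfl⟩,
    hmargin ⟨hu.1 j, hu.2 j⟩] using h

end CopulaMonotone

noncomputable section Sklar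

open Filter Topology

variable {Ω : Type*} [MeasurableSpace Ω] {P : Measure Ω}

lemma measureReal_iInter_eq_integral_prod {ι : Type*} [Fintype ι] {A : ι → Set Ω}
    (hA : ∀ i, MeasurableSet (A i)) :
    P.real (⋂ i, A i) = ∫ ω, ∏ i, (A i).indicator 1 ω ∂P := by
  rw [← integral_indicator_one (MeasurableSet.iInter hA)]
  refine integral_congr_ae (ae_of_all _ fun ω => ?_)
  by_cases h : ∀ i, ω ∈ A i
  · simp [h]
  · obtain ⟨i, hi⟩ := not_forall.1 h
    rw [Set.indicator_of_notMem (mt Set.mem_iInter.1 h)]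
    exact (Finset.prod_eq_zero (Finset.mem_univ i) (Set.indicator_of_notMem hi 1)).symm

lemma integrable_prod_indicator_one [IsFiniteMeasure P] {ι : Type*} [Fintype ι] {A : ι → Set Ω}
    (hA : ∀ i, MeasurableSet (A i)) :
    Integrable (fun ω => ∏ i, (A i).indicator (1 : Ω → ℝ) ω) P := by
  refine Integrable.of_bound (C := 1) ?_ (ae_of_all _ fun ω => ?_)
  · exact (Finset.measurable_fun_prod _ fun i _ =>
      measurable_one.indicator (hA i)).aestronglyMeasurable
  · rw [norm_prod]
    exact Finset.prod_le_one (fun _ _ => norm_nonneg _) fun i _ =>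
      (norm_indicator_le_norm_self _ _).trans norm_one.le

lemma sum_neg_one_pow_measureReal_iInter_nonneg [IsFiniteMeasure P] {ι : Type*} [Fintype ι]
    [DecidableEq ι] {A B : ι → Set Ω} (hA : ∀ i, MeasurableSet (A i))
    (hB : ∀ i, MeasurableSet (B i)) (hAB : ∀ i, A i ⊆ B i) :
    0 ≤ ∑ S : Finset ι, (-1 : ℝ) ^ S.card * P.real (⋂ i, S.piecewise A B i) := by
  have hm (S : Finset ι) (i : ι) : MeasurableSet (S.piecewise A B i) := by
    by_cases hi : i ∈ S <;> simp [hi, hA, hB]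
  have hexpand (ω : Ω) : ∏ i, ((B i).indicator (1 : Ω → ℝ) ω - (A i).indicator 1 ω) =
      ∑ S : Finset ι, (-1 : ℝ) ^ S.card * ∏ i, (S.piecewise A B i).indicator 1 ω := by
    rw [Finset.prod_sub, Finset.powerset_univ]
    refine Finset.sum_congr rfl fun S _ => ?_
    rw [mul_assoc, ← Finset.prod_sdiff (Finset.subset_univ S)]
    congr 2
    · refine Finset.prod_congr rfl fun i hi => ?_
      rw [Finset.piecewise_eq_of_notMem _ _ _ (Finset.mem_sdiff.1 hi).2]
    · exact Finset.prod_congr rfl fun i hi => by rw [Finset.piecewise_eq_of_mem _ _ _ hi]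
  simp_rw [measureReal_iInter_eq_integral_prod (hm _), ← integral_const_mul]
  rw [← integral_finsetSum _ fun S _ => (integrable_prod_indicator_one (hm S)).const_mul _]
  refine integral_nonneg fun ω => ?_
  rw [Pi.zero_apply, ← hexpand]
  exact Finset.prod_nonneg fun i _ => sub_nonneg.2
    (Set.indicator_le_indicator_of_subset (hAB i) (fun _ => zero_le_one) ω)

variable [IsProbabilityMeasure P] {n : ℕ}

lemma isCopula_of_uniform_marginals {U : Fin n → Ω → ℝ} (hU : ∀ i, Measurable (U i))
    (hunif : ∀ i, ∀ u ∈ Set.Icc (0 : ℝ) 1, P.real {ω | U i ω ≤ u} = u) :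
    IsCopula fun u : Fin n → ℝ => P.real {ω | ∀ i, U i ω ≤ u i} where
  mem_unit _ _ := ⟨measureReal_nonneg, measureReal_le_one⟩
  grounded u _ := by
    rintro ⟨i, hi⟩
    refine le_antisymm ?_ measureReal_nonneg
    rw [← hunif i 0 ⟨le_rfl, zero_le_one⟩]
    exact measureReal_mono fun ω hω => (hω i).trans_eq hi
  margin u hu j hj := by
    have hle_one (i : Fin n) : ∀ᵐ ω ∂P, U i ω ≤ 1 := by
      have h := hunif i 1 ⟨zero_le_one, le_rfl⟩
      rw [measureReal_def, ENNReal.toReal_eq_one_iff] at h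
      exact (mem_ae_iff_prob_eq_one (measurableSet_le (hU i) measurable_const)).2 h
    rw [← hunif j (u j) ⟨hu.1 j, hu.2 j⟩]
    refine measureReal_congr ?_
    filter_upwards [ae_all_iff.2 hle_one] with ω hω
    refine propext ⟨fun h => h j, fun h i => ?_⟩
    rcases eq_or_ne i j with rfl | hij
    exacts [h, (hω i).trans_eq (hj i hij).symm]
  volume_nonneg u _ v _ huv := by
    have hm (w : Fin n → ℝ) (i : Fin n) : MeasurableSet {ω | U i ω ≤ w i} :=
      measurableSet_le (hU i) measurable_const
    refine (sum_neg_one_pow_measureReal_iInter_nonneg (P := P) (hm u) (hm v) fun i ω hω =>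
      le_trans hω (huv i)).trans_eq (Finset.sum_congr rfl fun S _ => ?_)
    congr 2
    ext ω
    simp only [Set.mem_iInter, Set.mem_ofPred_eq, Finset.piecewise]
    exact forall_congr' fun i => by split_ifs <;> rfl

lemma ae_cdf_map_le_iff {X : Ω → ℝ} (hX : Measurable X) [NullSingletonClass (P.map X)] (x : ℝ) :
    ∀ᵐ ω ∂P, cdf (P.map X) (X ω) ≤ cdf (P.map X) x ↔ X ω ≤ x := by
  have := Measure.isProbabilityMeasure_map (μ := P) hX.aemeasurable
  have hsub : Set.Iic x ⊆ {z | cdf (P.map X) z ≤ cdf (P.map X) x} := fun z hz =>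
    monotone_cdf _ hz
  have hmeas : (P.map X).real {z | cdf (P.map X) z ≤ cdf (P.map X) x} =
      (P.map X).real (Set.Iic x) := by
    rw [measureReal_cdf_le ⟨cdf_nonneg _ _, cdf_le_one _ _⟩, cdf_eq_real]
  have hae := ae_eq_of_subset_of_measure_ge hsub
    ((measureReal_eq_measureReal_iff (by finiteness) (by finiteness)).1 hmeas).le
    measurableSet_Iic.nullMeasurableSet (measure_ne_top _ _)
  filter_upwards [ae_of_ae_map hX.aemeasurable hae] with ω hω
  exact (iff_of_eq hω).symm

/- Sklar's theorem: the copula is the joint distribution function of the uniform variables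
`F i (X i)`, where `F i` is the distribution function of `X i`. -/
theorem exists_isCopulaOf {X : Fin n → Ω → ℝ} (hX : ∀ i, Measurable (X i))
    (hatom : ∀ i, NullSingletonClass (P.map (X i))) : ∃ C, IsCopulaOf C X P := by
  have hprob (i : Fin n) : IsProbabilityMeasure (P.map (X i)) :=
    Measure.isProbabilityMeasure_map (hX i).aemeasurable
  have hcdf (i : Fin n) : Measurable (cdf (P.map (X i))) := (monotone_cdf _).measurable
  have hunif (i : Fin n) (u : ℝ) (hu : u ∈ Set.Icc (0 : ℝ) 1) :
      P.real {ω | cdf (P.map (X i)) (X i ω) ≤ u} = u := by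
    refine Eq.trans ?_ (measureReal_cdf_le (μ := P.map (X i)) hu)
    exact (map_measureReal_apply (hX i) (measurableSet_le (hcdf i) measurable_const)).symm
  refine ⟨_, isCopula_of_uniform_marginals (fun i => (hcdf i).comp (hX i)) hunif, fun x => ?_⟩
  refine measureReal_congr ?_
  filter_upwards [ae_all_iff.2 fun i => ae_cdf_map_le_iff (hX i) (x i)] with ω hω
  refine propext (forall_congr' fun i => (hω i).symm.trans ?_)
  rw [cdf_eq_real _ (x i), map_measureReal_apply (hX i) measurableSet_Iic]
  rfl

omit [IsProbabilityMeasure P] in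
lemma IsCopulaOf.congr {Ω' : Type*} [MeasurableSpace Ω'] {P' : Measure Ω'}
    {C : (Fin n → ℝ) → ℝ} {X : Fin n → Ω → ℝ} {Y : Fin n → Ω' → ℝ} (h : IsCopulaOf C X P)
    (hXY : IdentDistrib (fun ω i => X i ω) (fun ω i => Y i ω) P P') : IsCopulaOf C Y P' := by
  refine ⟨h.1, fun x => ?_⟩
  have hmargin (i : Fin n) : P.real {ω | X i ω ≤ x i} = P'.real {ω | Y i ω ≤ x i} :=
    congrArg ENNReal.toReal
      ((hXY.comp (measurable_pi_apply i)).measure_mem_eq (measurableSet_Iic (a := x i)))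
  simp_rw [← hmargin]
  refine Eq.trans ?_ (h.2 x)
  exact congrArg ENNReal.toReal (hXY.measure_mem_eq (measurableSet_Iic (a := x))).symm

omit [IsProbabilityMeasure P] in
lemma isCopulaOf_const_mul_iff {C : (Fin n → ℝ) → ℝ} {X : Fin n → Ω → ℝ} {c : ℝ} (hc : 0 < c) :
    IsCopulaOf C (fun i ω => c * X i ω) P ↔ IsCopulaOf C X P := by
  refine and_congr_right fun _ => ⟨fun h x => ?_, fun h x => ?_⟩
  · simpa only [mul_le_mul_iff_right₀ hc] using h fun i => c * x i
  · simpa only [le_div_iff₀' hc] using h fun i => x i / c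

lemma tendsto_measureReal_inter_le_atTop (X : Ω → ℝ) (A : Set Ω) :
    Tendsto (fun z : ℝ => P.real (A ∩ {ω | X ω ≤ z})) atTop (𝓝 (P.real A)) := by
  have hmono : Monotone fun z : ℝ => A ∩ {ω | X ω ≤ z} := fun a b hab ω hω =>
    ⟨hω.1, le_trans hω.2 hab⟩
  have hU : ⋃ z : ℝ, A ∩ {ω | X ω ≤ z} = A := by
    ext ω
    simpa only [Set.mem_iUnion, Set.mem_inter_iff, Set.mem_ofPred_eq, exists_and_left,
      and_iff_left_iff_imp] using fun _ => ⟨X ω, le_rfl⟩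
  have h := tendsto_measure_iUnion_atTop (μ := P) hmono
  rw [hU] at h
  exact (ENNReal.tendsto_toReal (measure_ne_top _ _)).comp h

lemma IsCopulaOf.apply_update_one {C : (Fin n → ℝ) → ℝ} {X : Fin n → Ω → ℝ}
    (h : IsCopulaOf C X P) (x : Fin n → ℝ) (j : Fin n) :
    C (Function.update (fun i => P.real {ω | X i ω ≤ x i}) j 1) =
      P.real {ω | ∀ i ≠ j, X i ω ≤ x i} := by
  set F : Fin n → ℝ := fun i => P.real {ω | X i ω ≤ x i}
  have hmem {p : ℝ} (hp : p ∈ Set.Icc (0 : ℝ) 1) : Function.update F j p ∈ Set.Icc 0 1 :=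
    ⟨le_update_iff.2 ⟨hp.1, fun _ _ => measureReal_nonneg⟩,
      update_le_iff.2 ⟨hp.2, fun _ _ => measureReal_le_one⟩⟩
  have hjoint (z : ℝ) : C (Function.update F j (P.real {ω | X j ω ≤ z})) =
      P.real ({ω | ∀ i ≠ j, X i ω ≤ x i} ∩ {ω | X j ω ≤ z}) := by
    convert (h.2 (Function.update x j z)).symm using 2
    · ext i
      rcases eq_or_ne i j with rfl | hij
      · simp only [Function.update_self]
      · simp only [Function.update_of_ne hij, F]
    · ext ω
      exact and_comm.trans (Function.forall_update_iff x fun i a => X i ω ≤ a).symm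
  have hle (z : ℝ) : ‖C (Function.update F j (P.real {ω | X j ω ≤ z})) -
      C (Function.update F j 1)‖ ≤ 1 - P.real {ω | X j ω ≤ z} := by
    have hp : P.real {ω | X j ω ≤ z} ∈ Set.Icc (0 : ℝ) 1 :=
      ⟨measureReal_nonneg, measureReal_le_one⟩
    have hlip := h.1.apply_update_one_sub_le (hmem hp) j
    have hmono := h.1.apply_update_le (hmem ⟨zero_le_one, le_rfl⟩) (k := j)
      (by rwa [Function.update_self])
    rw [Function.update_idem, Function.update_self] at hlip
    rw [Function.update_idem] at hmono
    rwa [norm_sub_rev, Real.norm_of_nonneg (sub_nonneg.2 hmono)]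
  have hone : Tendsto (fun z : ℝ => 1 - P.real {ω | X j ω ≤ z}) atTop (𝓝 0) := by
    simpa using (tendsto_measureReal_inter_le_atTop (P := P) (X j) Set.univ).const_sub 1
  refine tendsto_nhds_unique (tendsto_iff_norm_sub_tendsto_zero.2
    (squeeze_zero (fun _ => norm_nonneg _) hle hone)) ?_
  simp_rw [hjoint]
  exact tendsto_measureReal_inter_le_atTop _ _

/-- The mean `E[F_{X,Y}(X', Y')]` of the joint distribution function of `X` and `Y` at independent
copies `X'` of `X` and `Y'` of `Y`, on which Spearman's rho depends affinely. -/
def meanJointCdf (P : Measure Ω) (X Y : Ω → ℝ) : ℝ :=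
  ∫ y, ∫ x, P.real {ω | X ω ≤ x ∧ Y ω ≤ y} ∂P.map X ∂P.map Y

lemma IsCopulaOf.spearmanRho_insertNth_one {C : (Fin 3 → ℝ) → ℝ} {X : Fin 3 → Ω → ℝ}
    (h : IsCopulaOf C X P) (hX : ∀ i, Measurable (X i))
    (hatom : ∀ i, NullSingletonClass (P.map (X i))) (k : Fin 3) :
    spearmanRho (fun p => C (k.insertNth (1 : ℝ) p)) =
      12 * meanJointCdf P (X (k.succAbove 0)) (X (k.succAbove 1)) - 3 := by
  have hprob (i : Fin 3) : IsProbabilityMeasure (P.map (X i)) :=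
    Measure.isProbabilityMeasure_map (hX i).aemeasurable
  have hmono : MonotoneOn (fun p : Fin 2 → ℝ => C (k.insertNth (1 : ℝ) p)) (Set.Icc 0 1) := by
    intro p hp q hq hpq
    have hmem {r : Fin 2 → ℝ} (hr : r ∈ Set.Icc (0 : Fin 2 → ℝ) 1) :
        (k.insertNth (1 : ℝ) r : Fin 3 → ℝ) ∈ Set.Icc (0 : Fin 3 → ℝ) 1 :=
      Fin.insertNth_mem_Icc.2 ⟨⟨zero_le_one, le_rfl⟩, hr⟩
    exact h.1.monotoneOn (hmem hp) (hmem hq) (Fin.insertNth_le_iff.2 (by simpa using hpq))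
  have hcdf (i : Fin 3) (x : ℝ) : cdf (P.map (X i)) x = P.real {ω | X i ω ≤ x} := by
    rw [cdf_eq_real, map_measureReal_apply (hX i) measurableSet_Iic]
    rfl
  have hjoint (x y : ℝ) : C (k.insertNth (1 : ℝ) ![cdf (P.map (X (k.succAbove 0))) x,
      cdf (P.map (X (k.succAbove 1))) y]) =
      P.real {ω | X (k.succAbove 0) ω ≤ x ∧ X (k.succAbove 1) ω ≤ y} := by
    convert h.apply_update_one (k.insertNth (0 : ℝ) ![x, y]) k using 2
    · ext i
      refine Fin.succAboveCases k ?_ (fun j => ?_) i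
      · simp
      · fin_cases j <;> simp [hcdf]
    · ext ω
      simp [Fin.forall_iff_succAbove k, Fin.forall_fin_two]
  simp_rw [spearmanRho_eq_integral_cdf (μ := P.map (X (k.succAbove 0)))
    (ν := P.map (X (k.succAbove 1))) hmono, hjoint]
  rfl

end Sklar

section MeanJointCdf

lemma map_neg_eq_map_map {α : Type*} [MeasurableSpace α] {μ : Measure α} {f : α → ℝ}
    (hf : Measurable f) : μ.map (-f) = (μ.map f).map (-·) :=
  (Measure.map_map measurable_neg hf).symm

variable {Ω : Type*} [MeasurableSpace Ω] {P : Measure Ω} [IsProbabilityMeasure P] {X Y : Ω → ℝ}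

lemma measurable_measureReal_le_le (hX : Measurable X) (hY : Measurable Y) :
    Measurable fun p : ℝ × ℝ => P.real {ω | X ω ≤ p.2 ∧ Y ω ≤ p.1} :=
  (measurable_measure_prodMk_left (measurableSet_le (hX.comp measurable_snd)
    (measurable_snd.comp measurable_fst) |>.inter (measurableSet_le (hY.comp measurable_snd)
    (measurable_fst.comp measurable_fst)))).ennreal_toReal

lemma integrable_of_mem_Icc_zero_one {α : Type*} [MeasurableSpace α] {μ : Measure α}
    [IsFiniteMeasure μ] {f : α → ℝ} (hf : Measurable f) (h : ∀ x, f x ∈ Set.Icc (0 : ℝ) 1) :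
    Integrable f μ :=
  (integrable_const (1 : ℝ)).mono' hf.aestronglyMeasurable
    (ae_of_all _ fun x => (Real.norm_of_nonneg (h x).1).trans_le (h x).2)

lemma meanJointCdf_eq_integral_prod (hX : Measurable X) (hY : Measurable Y) :
    meanJointCdf P X Y =
      ∫ p, P.real {ω | X ω ≤ p.2 ∧ Y ω ≤ p.1} ∂(P.map Y).prod (P.map X) := by
  have := Measure.isProbabilityMeasure_map (μ := P) hX.aemeasurable
  have := Measure.isProbabilityMeasure_map (μ := P) hY.aemeasurable
  exact (integral_prod (fun p : ℝ × ℝ => P.real {ω | X ω ≤ p.2 ∧ Y ω ≤ p.1})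
    (integrable_of_mem_Icc_zero_one (measurable_measureReal_le_le hX hY)
      fun _ => ⟨measureReal_nonneg, measureReal_le_one⟩)).symm

lemma integral_cdf (μ : Measure ℝ) [IsProbabilityMeasure μ] [NullSingletonClass μ] :
    ∫ x, cdf μ x ∂μ = 1 / 2 := by
  have h := intervalIntegral_eq_integral_cdf (μ := μ) monotoneOn_id
  simp only [id] at h
  rw [← h, integral_id]
  norm_num

omit [IsProbabilityMeasure P] in
lemma ae_ne_of_nullSingletonClass_map (hX : Measurable X) [NullSingletonClass (P.map X)] (x : ℝ) :
    ∀ᵐ ω ∂P, X ω ≠ x :=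
  ae_of_ae_map hX.aemeasurable (Measure.ae_ne (P.map X) x)

lemma measureReal_le_neg_le_neg (hX : Measurable X) (hY : Measurable Y)
    [NullSingletonClass (P.map X)] [NullSingletonClass (P.map Y)] (x y : ℝ) :
    P.real {ω | (-X) ω ≤ -x ∧ (-Y) ω ≤ -y} = 1 - cdf (P.map X) x - cdf (P.map Y) y +
      P.real {ω | X ω ≤ x ∧ Y ω ≤ y} := by
  have := Measure.isProbabilityMeasure_map (μ := P) hX.aemeasurable
  have := Measure.isProbabilityMeasure_map (μ := P) hY.aemeasurable
  have hmX : MeasurableSet (X ⁻¹' Set.Iic x) := hX measurableSet_Iic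
  have hmY : MeasurableSet (Y ⁻¹' Set.Iic y) := hY measurableSet_Iic
  have hcompl : P.real {ω | (-X) ω ≤ -x ∧ (-Y) ω ≤ -y} =
      P.real (X ⁻¹' Set.Iic x ∪ Y ⁻¹' Set.Iic y)ᶜ := by
    refine measureReal_congr ?_
    filter_upwards [ae_ne_of_nullSingletonClass_map hX x,
      ae_ne_of_nullSingletonClass_map hY y] with ω hx hy
    refine propext ?_
    change (-X ω ≤ -x ∧ -Y ω ≤ -y) ↔ ¬(X ω ≤ x ∨ Y ω ≤ y)
    rw [not_or, not_le, not_le, neg_le_neg_iff, neg_le_neg_iff, hx.symm.le_iff_lt,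
      hy.symm.le_iff_lt]
  have hunion := measureReal_union_add_inter (μ := P) (s := X ⁻¹' Set.Iic x) hmY
  rw [hcompl, probReal_compl_eq_one_sub (hmX.union hmY), cdf_eq_real, cdf_eq_real,
    map_measureReal_apply hX measurableSet_Iic, map_measureReal_apply hY measurableSet_Iic]
  change _ = _ + P.real (X ⁻¹' Set.Iic x ∩ Y ⁻¹' Set.Iic y)
  linarith

lemma meanJointCdf_neg_neg (hX : Measurable X) (hY : Measurable Y)
    [NullSingletonClass (P.map X)] [NullSingletonClass (P.map Y)] :
    meanJointCdf P (-X) (-Y) = meanJointCdf P X Y := by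
  have := Measure.isProbabilityMeasure_map (μ := P) hX.aemeasurable
  have := Measure.isProbabilityMeasure_map (μ := P) hY.aemeasurable
  have hcdf (μ : Measure ℝ) (x : ℝ) : cdf μ x ∈ Set.Icc (0 : ℝ) 1 :=
    ⟨cdf_nonneg μ x, cdf_le_one μ x⟩
  have hIX : Integrable (fun p : ℝ × ℝ => cdf (P.map X) p.2) ((P.map Y).prod (P.map X)) :=
    integrable_of_mem_Icc_zero_one ((monotone_cdf _).measurable.comp measurable_snd)
      fun _ => hcdf _ _
  have hIY : Integrable (fun p : ℝ × ℝ => cdf (P.map Y) p.1) ((P.map Y).prod (P.map X)) :=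
    integrable_of_mem_Icc_zero_one ((monotone_cdf _).measurable.comp measurable_fst)
      fun _ => hcdf _ _
  have hIJ : Integrable (fun p : ℝ × ℝ => P.real {ω | X ω ≤ p.2 ∧ Y ω ≤ p.1})
      ((P.map Y).prod (P.map X)) :=
    integrable_of_mem_Icc_zero_one (measurable_measureReal_le_le hX hY)
      fun _ => ⟨measureReal_nonneg, measureReal_le_one⟩
  have hIX' : Integrable (fun p : ℝ × ℝ => 1 - cdf (P.map X) p.2) ((P.map Y).prod (P.map X)) :=
    (integrable_const 1).sub hIX
  have hIXY : Integrable (fun p : ℝ × ℝ => 1 - cdf (P.map X) p.2 - cdf (P.map Y) p.1)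
      ((P.map Y).prod (P.map X)) := hIX'.sub hIY
  rw [meanJointCdf_eq_integral_prod hX.neg hY.neg, map_neg_eq_map_map hX, map_neg_eq_map_map hY,
    Measure.map_prod_map _ _ measurable_neg measurable_neg,
    integral_map (measurable_neg.prodMap measurable_neg).aemeasurable
      (measurable_measureReal_le_le hX.neg hY.neg).aestronglyMeasurable,
    meanJointCdf_eq_integral_prod hX hY]
  simp only [Prod.map, measureReal_le_neg_le_neg hX hY]
  rw [integral_add hIXY hIJ, integral_sub hIX' hIY, integral_sub (integrable_const 1) hIX,
    integral_fun_snd fun x => cdf (P.map X) x, integral_fun_fst fun y => cdf (P.map Y) y,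
    integral_cdf, integral_cdf]
  norm_num

end MeanJointCdf

noncomputable section Extrema

open Filter Topology

section Path

variable {Ω : Type*} {W V : ℝ≥0 → Ω → ℝ} {ω : Ω} {t : ℝ≥0}

lemma runningMax_lt_iff (hc : Continuous (W · ω)) {y : ℝ} :
    runningMax W t ω < y ↔ ∀ s ≤ t, W s ω < y := by
  rw [runningMax, isCompact_Icc.sSup_lt_iff_of_continuous ⟨0, by simp⟩ hc.continuousOn]
  simp

lemma lt_runningMin_iff (hc : Continuous (W · ω)) {y : ℝ} :
    y < runningMin W t ω ↔ ∀ s ≤ t, y < W s ω := by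
  rw [runningMin, isCompact_Icc.lt_sInf_iff_of_continuous ⟨0, by simp⟩ hc.continuousOn]
  simp

lemma le_runningMax (hc : Continuous (W · ω)) {s : ℝ≥0} (h : s ≤ t) :
    W s ω ≤ runningMax W t ω :=
  le_of_forall_gt fun _ hy => (runningMax_lt_iff hc).1 hy s h

lemma runningMin_eq_neg_runningMax_neg (W : ℝ≥0 → Ω → ℝ) (t : ℝ≥0) :
    runningMin W t = -runningMax (-W) t := by
  ext ω
  rw [runningMin, Pi.neg_apply, runningMax, Real.sInf_def, ← Set.image_neg_eq_neg, Set.image_image]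
  rfl

lemma runningMax_congr (h : ∀ s, W s ω = V s ω) : runningMax W t ω = runningMax V t ω := by
  simp_rw [runningMax, h]

lemma wienerTriple_congr (h : ∀ s, W s ω = V s ω) (i : Fin 3) :
    wienerTriple W t i ω = wienerTriple V t i ω := by
  fin_cases i
  · exact h t
  · exact runningMax_congr h
  · change runningMin W t ω = runningMin V t ω
    simp_rw [runningMin, h]

/-- The triple (end point, supremum, infimum) of a path on `[0, t]`. The extrema run over a
countable dense set of times, which makes them measurable for the product σ-algebra. -/
def pathTriple (t : ℝ≥0) (w : ℝ≥0 → ℝ) : Fin 3 → ℝ :=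
  ![w t, ⨆ k, w (TopologicalSpace.denseSeq (Set.Iic t) k),
    ⨅ k, w (TopologicalSpace.denseSeq (Set.Iic t) k)]

lemma measurable_pathTriple (t : ℝ≥0) : Measurable (pathTriple t) := by
  refine measurable_pi_lambda _ fun i => ?_
  fin_cases i
  · exact measurable_pi_apply _
  · exact Measurable.iSup fun k => measurable_pi_apply _
  · exact Measurable.iInf fun k => measurable_pi_apply _

lemma wienerTriple_eq_pathTriple (hc : Continuous (W · ω)) (i : Fin 3) :
    wienerTriple W t i ω = pathTriple t (W · ω) i := by
  have hIcc : Set.Icc 0 t = Set.Iic t := Set.Icc_bot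
  have hdense := TopologicalSpace.denseRange_denseSeq (Set.Iic t)
  have hcont : Continuous fun s : Set.Iic t => W s ω := hc.comp continuous_subtype_val
  fin_cases i
  · rfl
  · change runningMax W t ω = _
    rw [runningMax, hIcc, sSup_image', ← hdense.ciSup' hcont]
    exact iSup_range' (fun s : Set.Iic t => W s ω) _
  · change runningMin W t ω = _
    rw [runningMin, hIcc, sInf_image', ← hdense.ciInf' hcont]
    exact iInf_range' (fun s : Set.Iic t => W s ω) _

lemma image_const_mul_comp_mul (W : ℝ≥0 → Ω → ℝ) (c : ℝ) (ht : 0 < t) (ω : Ω) :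
    (fun s => c * W (t * s) ω) '' Set.Icc 0 1 = (c * ·) '' ((fun s => W s ω) '' Set.Icc 0 t) := by
  have hIcc := (OrderIso.mulLeft₀ t ht).image_Icc 0 1
  simp only [OrderIso.mulLeft₀_apply, mul_zero, mul_one] at hIcc
  simp_rw [← hIcc, Set.image_image]

lemma wienerTriple_const_mul_comp_mul (W : ℝ≥0 → Ω → ℝ) {c : ℝ} (hc : 0 ≤ c) (ht : 0 < t) :
    wienerTriple (fun s ω => c * W (t * s) ω) 1 = fun i ω => c * wienerTriple W t i ω := by
  ext i ω
  fin_cases i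
  · simp [wienerTriple]
  · exact (congrArg sSup (image_const_mul_comp_mul W c ht ω)).trans
      (Real.sSup_smul_of_nonneg hc _)
  · exact (congrArg sInf (image_const_mul_comp_mul W c ht ω)).trans
      (Real.sInf_smul_of_nonneg hc _)

end Path

variable {Ω : Type*} [MeasurableSpace Ω] {P : Measure Ω} {W V : ℝ≥0 → Ω → ℝ} {t : ℝ≥0}
  {C : (Fin 3 → ℝ) → ℝ}

lemma IsRegularBrownian.neg (hW : IsRegularBrownian W P) : IsRegularBrownian (-W) P where
  toIsPreBrownianReal := hW.toIsPreBrownianReal.neg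
  measurable_eval t := (hW.measurable_eval t).neg
  continuous_path ω := (hW.continuous_path ω).neg
  eval_zero ω := neg_eq_zero.2 (hW.eval_zero ω)

lemma IsRegularBrownian.measurable_path (hW : IsRegularBrownian W P) :
    Measurable fun ω s => W s ω := measurable_pi_lambda _ hW.measurable_eval

lemma IsRegularBrownian.wienerTriple_eq (hW : IsRegularBrownian W P) (t : ℝ≥0) :
    (fun ω i => wienerTriple W t i ω) = pathTriple t ∘ fun ω s => W s ω :=
  funext fun ω => funext fun i => wienerTriple_eq_pathTriple (hW.continuous_path ω) i

lemma IsRegularBrownian.measurable_wienerTriple (hW : IsRegularBrownian W P) (t : ℝ≥0)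
    (i : Fin 3) : Measurable (wienerTriple W t i) :=
  measurable_pi_iff.1 (hW.wienerTriple_eq t ▸
    (measurable_pathTriple t).comp hW.measurable_path) i

lemma IsRegularBrownian.identDistrib_path (hW : IsRegularBrownian W P)
    (hV : IsRegularBrownian V P) :
    IdentDistrib (fun ω s => W s ω) (fun ω s => V s ω) P P where
  aemeasurable_fst := hW.measurable_path.aemeasurable
  aemeasurable_snd := hV.measurable_path.aemeasurable
  map_eq := by
    have := hW.isProbabilityMeasure
    rw [map_eq_iff_forall_finset_map_restrict_eq hW.measurable_path.aemeasurable
      hV.measurable_path.aemeasurable]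
    exact fun I => (hW.hasLaw I).map_eq.trans (hV.hasLaw I).map_eq.symm

lemma IsRegularBrownian.identDistrib_wienerTriple (hW : IsRegularBrownian W P)
    (hV : IsRegularBrownian V P) (t : ℝ≥0) :
    IdentDistrib (fun ω i => wienerTriple W t i ω) (fun ω i => wienerTriple V t i ω) P P := by
  rw [hW.wienerTriple_eq, hV.wienerTriple_eq]
  exact (hW.identDistrib_path hV).comp (measurable_pathTriple t)

lemma IsRegularBrownian.identDistrib_wienerTriple_of_ae_eq (hV : IsRegularBrownian V P)
    (h : ∀ᵐ ω ∂P, ∀ t, W t ω = V t ω) (t : ℝ≥0) :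
    IdentDistrib (fun ω i => wienerTriple W t i ω) (fun ω i => wienerTriple V t i ω) P P := by
  refine (IdentDistrib.of_ae_eq
    (measurable_pi_lambda _ (hV.measurable_wienerTriple t)).aemeasurable ?_).symm
  filter_upwards [h] with ω hω using funext fun i => (wienerTriple_congr hω i).symm

lemma identDistrib_wienerTriple_scale (hW : IsBrownianReal W P) (hV : IsRegularBrownian V P)
    (ht : 0 < t) : IdentDistrib (fun ω i => (√(t : ℝ))⁻¹ * wienerTriple W t i ω)
      (fun ω i => wienerTriple V 1 i ω) P P := by
  obtain ⟨V', hV', hae⟩ := exists_isRegularBrownian (hW.smul ht.ne')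
  have hscale := (hV'.identDistrib_wienerTriple_of_ae_eq hae 1).trans
    (hV'.identDistrib_wienerTriple hV 1)
  simp_rw [wienerTriple_const_mul_comp_mul W (inv_nonneg.2 (Real.sqrt_nonneg _)) ht] at hscale
  exact hscale

theorem isCopulaOf_wienerTriple_iff (hW : IsBrownianReal W P) (hV : IsRegularBrownian V P)
    (ht : 0 < t) : IsCopulaOf C (wienerTriple W t) P ↔ IsCopulaOf C (wienerTriple V 1) P := by
  have hscale := identDistrib_wienerTriple_scale hW hV ht
  rw [← isCopulaOf_const_mul_iff (inv_pos.2 (Real.sqrt_pos.2 (NNReal.coe_pos.2 ht)))]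
  exact ⟨fun h => h.congr hscale, fun h => h.congr hscale.symm⟩

lemma IsRegularBrownian.map_eval (hW : IsRegularBrownian W P) (t : ℝ≥0) :
    P.map (W t) = gaussianReal 0 t := (hW.hasLaw_eval t).map_eq

lemma IsRegularBrownian.measurable_runningMax (hW : IsRegularBrownian W P) (t : ℝ≥0) :
    Measurable (runningMax W t) := hW.measurable_wienerTriple t 1

lemma IsRegularBrownian.measureReal_runningMax_lt (hW : IsRegularBrownian W P) {y : ℝ}
    (hy : 0 < y) :
    P.real {ω | runningMax W t ω < y} = (gaussianReal 0 t).real (Set.Ioc (-y) y) := by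
  have hdiff := measureReal_sdiff (μ := gaussianReal 0 t)
    (Set.Iic_subset_Iic.2 (by linarith : -y ≤ y)) measurableSet_Iic
  have hjoint := hW.measureReal_le_forall_lt t hy le_rfl
  rw [show y - 2 * y = -y by ring, ← hdiff, Set.Iic_sdiff_Iic] at hjoint
  rw [← hjoint]
  congr 1
  ext ω
  simp only [Set.mem_ofPred_eq, runningMax_lt_iff (hW.continuous_path ω)]
  exact ⟨fun h => ⟨(h t le_rfl).le, h⟩, fun h => h.2⟩

lemma map_abs_gaussianReal (ht : t ≠ 0) :
    (gaussianReal 0 t).map (|·|) = (2 : ℝ≥0) • (gaussianReal 0 t).restrict (Set.Ioi 0) := by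
  have := nullSingletonClass_gaussianReal (μ := 0) ht
  have habs : Measurable fun x : ℝ => |x| := continuous_abs.measurable
  have hpos : (fun x : ℝ => |x|) =ᵐ[(gaussianReal 0 t).restrict (Set.Ioi 0)] id :=
    (ae_restrict_mem measurableSet_Ioi).mono fun x hx => abs_of_pos hx
  have hneg : (fun x : ℝ => |x|) =ᵐ[(gaussianReal 0 t).restrict (Set.Ioi 0)ᶜ] (-·) :=
    (ae_restrict_mem measurableSet_Ioi.compl).mono fun x hx => abs_of_nonpos (not_lt.1 hx)
  have hpre : (Set.Ioi 0)ᶜ = (-·) ⁻¹' Set.Ici (0 : ℝ) := by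
    ext x
    simp
  calc (gaussianReal 0 t).map (|·|)
      = ((gaussianReal 0 t).restrict (Set.Ioi 0)).map (|·|) +
        ((gaussianReal 0 t).restrict (Set.Ioi 0)ᶜ).map (|·|) := by
        rw [← Measure.map_add _ _ habs, Measure.restrict_add_restrict_compl measurableSet_Ioi]
    _ = (gaussianReal 0 t).restrict (Set.Ioi 0) + (gaussianReal 0 t).restrict (Set.Ioi 0) := by
        rw [Measure.map_congr hpos, Measure.map_congr hneg, Measure.map_id, hpre,
          ← Measure.restrict_map measurable_neg measurableSet_Ici, gaussianReal_map_neg, neg_zero,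
          Measure.restrict_congr_set Ioi_ae_eq_Ici]
    _ = (2 : ℝ≥0) • (gaussianReal 0 t).restrict (Set.Ioi 0) := (two_smul _ _).symm

lemma IsRegularBrownian.map_runningMax_eq_map_abs (hW : IsRegularBrownian W P) (ht : t ≠ 0) :
    P.map (runningMax W t) = (gaussianReal 0 t).map (|·|) := by
  have := hW.isProbabilityMeasure
  have := nullSingletonClass_gaussianReal (μ := 0) ht
  have hM := hW.measurable_runningMax t
  have habs : Measurable fun x : ℝ => |x| := continuous_abs.measurable
  have := Measure.isProbabilityMeasure_map (μ := P) hM.aemeasurable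
  have := Measure.isProbabilityMeasure_map (μ := gaussianReal 0 t) habs.aemeasurable
  refine Measure.ext_of_Ici _ _ fun y => ?_
  suffices (P.map (runningMax W t)).real (Set.Iio y) =
      ((gaussianReal 0 t).map (|·|)).real (Set.Iio y) by
    rw [← Set.compl_Iio, prob_compl_eq_one_sub measurableSet_Iio,
      prob_compl_eq_one_sub measurableSet_Iio, (measureReal_eq_measureReal_iff).1 this]
  rw [map_measureReal_apply hM measurableSet_Iio, map_measureReal_apply habs measurableSet_Iio]
  rcases le_or_gt y 0 with hy | hy
  · have hnonneg (ω : Ω) : 0 ≤ runningMax W t ω :=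
      hW.eval_zero ω ▸ le_runningMax (hW.continuous_path ω) zero_le
    have hempty : runningMax W t ⁻¹' Set.Iio y = ∅ :=
      Set.eq_empty_of_forall_notMem fun ω => not_lt.2 (hy.trans (hnonneg ω))
    have hempty' : (|·|) ⁻¹' Set.Iio y = (∅ : Set ℝ) :=
      Set.eq_empty_of_forall_notMem fun x => not_lt.2 (hy.trans (abs_nonneg x))
    rw [hempty, hempty', measureReal_empty, measureReal_empty]
  · have hIoo : (|·|) ⁻¹' Set.Iio y = Set.Ioo (-y) y := Set.ext fun x => abs_lt (a := x)
    rw [hIoo]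
    exact (hW.measureReal_runningMax_lt hy).trans (measureReal_congr Ioo_ae_eq_Ioc.symm)

theorem IsRegularBrownian.map_runningMax (hW : IsRegularBrownian W P) (ht : t ≠ 0) :
    P.map (runningMax W t) = (2 : ℝ≥0) • (gaussianReal 0 t).restrict (Set.Ioi 0) :=
  (hW.map_runningMax_eq_map_abs ht).trans (map_abs_gaussianReal ht)

theorem IsRegularBrownian.map_runningMin (hW : IsRegularBrownian W P) (ht : t ≠ 0) :
    P.map (runningMin W t) = (2 : ℝ≥0) • (gaussianReal 0 t).restrict (Set.Iio 0) := by
  have hpre : Set.Ioi 0 = (-·) ⁻¹' Set.Iio (0 : ℝ) := by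
    ext x
    simp
  rw [runningMin_eq_neg_runningMax_neg, map_neg_eq_map_map (hW.neg.measurable_runningMax t),
    hW.neg.map_runningMax ht, Measure.map_smul, hpre,
    ← Measure.restrict_map measurable_neg measurableSet_Iio, gaussianReal_map_neg, neg_zero]

lemma IsRegularBrownian.nullSingletonClass_map_wienerTriple (hW : IsRegularBrownian W P)
    (ht : t ≠ 0) (i : Fin 3) : NullSingletonClass (P.map (wienerTriple W t i)) := by
  have := nullSingletonClass_gaussianReal (μ := 0) ht
  fin_cases i
  · exact hW.map_eval t ▸ this
  · exact hW.map_runningMax ht ▸ ⟨fun y => by simp⟩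
  · exact hW.map_runningMin ht ▸ ⟨fun y => by simp⟩

theorem IsRegularBrownian.exists_isCopulaOf (hW : IsRegularBrownian W P) (ht : t ≠ 0) :
    ∃ C, IsCopulaOf C (wienerTriple W t) P :=
  have := hW.isProbabilityMeasure
  _root_.exists_isCopulaOf (hW.measurable_wienerTriple t)
    (hW.nullSingletonClass_map_wienerTriple ht)

theorem IsRegularBrownian.measureReal_eval_le_runningMax_le (hW : IsRegularBrownian W P)
    (ht : t ≠ 0) (x : ℝ) {y : ℝ} (hy : 0 < y) :
    P.real {ω | W t ω ≤ x ∧ runningMax W t ω ≤ y} =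
      (gaussianReal 0 t).real (Set.Iio (min x y)) -
        (gaussianReal 0 t).real (Set.Iio (min x y - 2 * y)) := by
  have := nullSingletonClass_gaussianReal (μ := 0) ht
  have : NullSingletonClass (P.map (runningMax W t)) :=
    hW.nullSingletonClass_map_wienerTriple ht 1
  rw [measureReal_congr (μ := gaussianReal 0 t) Iio_ae_eq_Iic,
    measureReal_congr (μ := gaussianReal 0 t) Iio_ae_eq_Iic,
    ← hW.measureReal_le_forall_lt t hy (min_le_right x y)]
  refine measureReal_congr ?_
  filter_upwards [ae_ne_of_nullSingletonClass_map (hW.measurable_runningMax t) y] with ω hne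
  refine propext ?_
  change (W t ω ≤ x ∧ runningMax W t ω ≤ y) ↔ (W t ω ≤ min x y ∧ ∀ s ≤ t, W s ω < y)
  rw [← runningMax_lt_iff (hW.continuous_path ω), hne.le_iff_lt]
  exact ⟨fun h => ⟨le_min h.1 ((le_runningMax (hW.continuous_path ω) le_rfl).trans h.2.le), h.2⟩,
    fun h => ⟨h.1.trans (min_le_left x y), h.2⟩⟩

theorem IsRegularBrownian.measureReal_runningMax_le_runningMin_le (hW : IsRegularBrownian W P)
    (ht : t ≠ 0) {x y : ℝ} (hx : x < 0) (hy : 0 < y) :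
    P.real {ω | runningMax W t ω ≤ y ∧ runningMin W t ω ≤ x} =
      cdf (P.map (runningMax W t)) y - ∫ z, squareWave ((z - x) / (y - x)) ∂gaussianReal 0 t := by
  have := hW.isProbabilityMeasure
  have : NullSingletonClass (P.map (runningMax W t)) :=
    hW.nullSingletonClass_map_wienerTriple ht 1
  have hM := hW.measurable_runningMax t
  have := Measure.isProbabilityMeasure_map (μ := P) hM.aemeasurable
  have hstay : P.real (runningMax W t ⁻¹' Set.Iic y \ runningMin W t ⁻¹' Set.Iic x) =
      ∫ z, squareWave ((z - x) / (y - x)) ∂gaussianReal 0 t := by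
    simp_rw [sub_eq_add_neg _ x, add_comm y (-x)]
    rw [← hW.measureReal_forall_mem_Ioo t (neg_pos.2 hx) hy, neg_neg]
    refine measureReal_congr ?_
    filter_upwards [ae_ne_of_nullSingletonClass_map hM y] with ω hne
    refine propext ?_
    change (runningMax W t ω ≤ y ∧ ¬ runningMin W t ω ≤ x) ↔ ∀ s ≤ t, x < W s ω ∧ W s ω < y
    rw [hne.le_iff_lt, not_le, runningMax_lt_iff (hW.continuous_path ω),
      lt_runningMin_iff (hW.continuous_path ω), and_comm]
    simp only [forall_and]
  rw [cdf_eq_real, map_measureReal_apply hM measurableSet_Iic, ← hstay, eq_sub_iff_add_eq]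
  exact measureReal_inter_add_sdiff (hW.measurable_wienerTriple t 2 measurableSet_Iic)

end Extrema

section MaxCones

open scoped Real

lemma arccos_one_div_sqrt_two : Real.arccos (1 / √2) = π / 4 :=
  Real.arccos_eq_of_eq_cos (by positivity) (by linarith [Real.pi_pos])
    (by rw [Real.cos_pi_div_four, one_div, Real.sqrt_div_self])

lemma measureReal_stdNormal3_max_cone :
    stdNormal3.real {p | 0 < p.2.1 ∧ p.1 < min p.2.2 p.2.1} = 11 / 48 := by
  have hset : {p : ℝ × ℝ × ℝ | 0 < p.2.1 ∧ p.1 < min p.2.2 p.2.1} =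
      {p | 0 < dot3 (0, 1, 0) p ∧ 0 < dot3 (-1, 0, 1) p ∧ 0 < dot3 (-1, 1, 0) p} := by
    ext p
    simp only [dot3, Set.mem_ofPred_eq, lt_min_iff]
    grind
  have hthird : Real.arccos (1 / 2) = π / 3 :=
    Real.arccos_eq_of_eq_cos (by positivity) (by linarith [Real.pi_pos])
      Real.cos_pi_div_three.symm
  have hsq : √(2 * 2) = (2 : ℝ) := Real.sqrt_mul_self zero_le_two
  rw [hset, measureReal_stdNormal3_three_halfSpaces (by simp) (by simp) (by simp)]
  norm_num [dot3, hsq, hthird, ← one_div, arccos_one_div_sqrt_two]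
  field_simp
  ring

lemma measureReal_stdNormal3_reflected_cone :
    stdNormal3.real {p | 0 < p.2.1 ∧ p.1 < min p.2.2 p.2.1 - 2 * p.2.1} =
      1 / 48 + Real.arccos (√6 / 3) / (4 * π) := by
  have hset : {p : ℝ × ℝ × ℝ | 0 < p.2.1 ∧ p.1 < min p.2.2 p.2.1 - 2 * p.2.1} =
      {p | 0 < dot3 (0, 1, 0) p ∧ 0 < dot3 (-1, -2, 1) p ∧ 0 < dot3 (-1, -1, 0) p} := by
    ext p
    simp only [dot3, Set.mem_ofPred_eq, lt_sub_iff_add_lt, lt_min_iff]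
    grind
  have hsq : √12 = 2 * √3 := by
    rw [show (12 : ℝ) = 2 ^ 2 * 3 by norm_num, Real.sqrt_mul (by norm_num),
      Real.sqrt_sq zero_le_two]
  have hsixth : Real.arccos (3 / (2 * √3)) = π / 6 := by
    refine Real.arccos_eq_of_eq_cos (by positivity) (by linarith [Real.pi_pos]) ?_
    rw [Real.cos_pi_div_six, div_mul_eq_div_div_swap, Real.div_sqrt]
  have hsix : 2 / √6 = √6 / 3 := by
    rw [div_eq_div_iff (by positivity) (by norm_num), Real.mul_self_sqrt (by norm_num)]
    norm_num
  rw [hset, measureReal_stdNormal3_three_halfSpaces (by simp) (by simp) (by simp)]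
  norm_num [dot3, hsq, hsixth, hsix, neg_div, Real.arccos_neg, ← one_div, arccos_one_div_sqrt_two]
  generalize Real.arccos (√6 / 3) = a
  field_simp
  ring

end MaxCones

section EndpointMaximum

lemma measureReal_prod_restrict {α β : Type*} [MeasurableSpace α] [MeasurableSpace β]
    {μ : Measure α} {ν : Measure β} [SFinite μ] [SFinite ν] (s : Set β) {t : Set (α × β)}
    (ht : MeasurableSet t) :
    (μ.prod (ν.restrict s)).real t = (μ.prod ν).real {p | p.2 ∈ s ∧ p ∈ t} := by
  rw [← Measure.restrict_univ (μ := μ), Measure.prod_restrict, measureReal_restrict_apply ht,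
    Measure.restrict_univ]
  congr 1
  ext p
  simp [and_comm]

lemma integral_measureReal_Iio {α : Type*} [MeasurableSpace α] {μ : Measure ℝ} {ν : Measure α}
    [IsFiniteMeasure μ] [IsFiniteMeasure ν] {f : α → ℝ} (hf : Measurable f) :
    ∫ a, μ.real (Set.Iio (f a)) ∂ν = (μ.prod ν).real {p | p.1 < f p.2} := by
  have hs : MeasurableSet {p : ℝ × α | p.1 < f p.2} :=
    measurableSet_lt measurable_fst (hf.comp measurable_snd)
  rw [measureReal_def, Measure.prod_apply_symm hs, ← integral_toReal
    (measurable_measure_prodMk_right hs).aemeasurable (ae_of_all _ fun _ => measure_lt_top _ _)]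
  rfl

lemma integrable_measureReal_Iio {α : Type*} [MeasurableSpace α] {μ : Measure ℝ} {ν : Measure α}
    [IsProbabilityMeasure μ] [IsFiniteMeasure ν] {f : α → ℝ} (hf : Measurable f) :
    Integrable (fun a => μ.real (Set.Iio (f a))) ν :=
  have hmono : Monotone fun x => μ.real (Set.Iio x) :=
    fun _ _ h => measureReal_mono (Set.Iio_subset_Iio h)
  integrable_of_mem_Icc_zero_one (hmono.measurable.comp hf)
    fun _ => ⟨measureReal_nonneg, measureReal_le_one⟩

variable {Ω : Type*} [MeasurableSpace Ω] {P : Measure Ω} {W : ℝ≥0 → Ω → ℝ}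

lemma IsRegularBrownian.meanJointCdf_eval_runningMax (hW : IsRegularBrownian W P) :
    meanJointCdf P (W 1) (runningMax W 1) =
      5 / 12 - Real.arccos (√6 / 3) / (2 * Real.pi) := by
  have := hW.isProbabilityMeasure
  let ν : Measure (ℝ × ℝ) := (stdNormal.prod stdNormal).restrict (Set.Ioi 0 ×ˢ Set.univ)
  have hlaw : (P.map (runningMax W 1)).prod (P.map (W 1)) = (2 : ℝ≥0) • ν := by
    rw [hW.map_runningMax one_ne_zero, hW.map_eval, Measure.prod_smul_left,
      ← Measure.restrict_univ (μ := gaussianReal 0 1), Measure.prod_restrict,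
      Measure.restrict_univ]
  have hpos : ∀ᵐ p ∂ν, 0 < p.1 :=
    (ae_restrict_mem (measurableSet_Ioi.prod .univ)).mono fun p hp => hp.1
  have hcone {f : ℝ × ℝ → ℝ} (hf : Measurable f) : ∫ p, stdNormal.real (Set.Iio (f p)) ∂ν =
      stdNormal3.real {p | 0 < p.2.1 ∧ p.1 < f p.2} := by
    rw [integral_measureReal_Iio hf, measureReal_prod_restrict (t := {p | p.1 < f p.2}) _
      (measurableSet_lt measurable_fst (hf.comp measurable_snd))]
    simp
  have hmin : Measurable fun p : ℝ × ℝ => min p.2 p.1 := by fun_prop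
  have hmin' : Measurable fun p : ℝ × ℝ => min p.2 p.1 - 2 * p.1 := by fun_prop
  rw [meanJointCdf_eq_integral_prod (hW.measurable_eval 1) (hW.measurable_runningMax 1), hlaw,
    integral_smul_nnreal_measure, integral_congr_ae (hpos.mono fun p hp =>
      hW.measureReal_eval_le_runningMax_le one_ne_zero p.2 hp),
    integral_sub (integrable_measureReal_Iio hmin) (integrable_measureReal_Iio hmin'),
    hcone hmin, hcone hmin', measureReal_stdNormal3_max_cone,
    measureReal_stdNormal3_reflected_cone, NNReal.smul_def]
  simp
  ring

lemma IsRegularBrownian.meanJointCdf_eval_runningMin (hW : IsRegularBrownian W P) :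
    meanJointCdf P (W 1) (runningMin W 1) =
      5 / 12 - Real.arccos (√6 / 3) / (2 * Real.pi) := by
  have := hW.isProbabilityMeasure
  have : NullSingletonClass (P.map ((-W) 1)) :=
    hW.neg.nullSingletonClass_map_wienerTriple one_ne_zero 0
  have : NullSingletonClass (P.map (runningMax (-W) 1)) :=
    hW.neg.nullSingletonClass_map_wienerTriple one_ne_zero 1
  rw [← hW.neg.meanJointCdf_eval_runningMax, runningMin_eq_neg_runningMax_neg,
    ← meanJointCdf_neg_neg (hW.neg.measurable_eval 1) (hW.neg.measurable_runningMax 1)]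
  congr 1
  exact (neg_neg (W 1)).symm

end EndpointMaximum

section SquareWaveSeries

variable {ν : Measure ℝ} [IsFiniteMeasure ν]

lemma integrable_squareWave_comp {α : Type*} [MeasurableSpace α] {μ : Measure α}
    [IsFiniteMeasure μ] {f : α → ℝ} (hf : Measurable f) :
    Integrable (fun a => squareWave (f a)) μ :=
  .of_bound (measurable_squareWave.comp hf).aestronglyMeasurable 1
    (ae_of_all _ fun a => abs_squareWave_le (f a))

lemma setIntegral_squareWave_Ioc [NullSingletonClass ν] (k : ℤ) :
    ∫ u in Set.Ioc (k : ℝ) (k + 1), squareWave u ∂ν =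
      (-1) ^ k * (ν.real (Set.Ioi (k : ℝ)) - ν.real (Set.Ioi (k + 1 : ℝ))) := by
  have hwave : ∀ u ∈ Set.Ioo (k : ℝ) (k + 1), squareWave u = (-1) ^ k := fun u hu => by
    have hshift := squareWave_add_intCast (u - k) k
    rwa [sub_add_cancel, squareWave_of_mem_Ioo ⟨sub_pos.2 hu.1, sub_left_lt_of_lt_add hu.2⟩,
      mul_one] at hshift
  have hdiff : Set.Ioi (k : ℝ) \ Set.Ioi (k + 1 : ℝ) = Set.Ioc (k : ℝ) (k + 1) := by
    rw [Set.Ioi_sdiff_Ioi]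
  rw [← measureReal_sdiff (Set.Ioi_subset_Ioi (by simp)) measurableSet_Ioi, hdiff,
    ← measureReal_congr Ioo_ae_eq_Ioc, ← integral_Ioc_eq_integral_Ioo.symm,
    setIntegral_congr_fun measurableSet_Ioo hwave, setIntegral_const, smul_eq_mul, mul_comm]

lemma hasSum_integral_squareWave [NullSingletonClass ν] :
    HasSum (fun k : ℤ => (-1 : ℝ) ^ k *
      (ν.real (Set.Ioi (k : ℝ)) - ν.real (Set.Ioi (k + 1 : ℝ)))) (∫ u, squareWave u ∂ν) := by
  have hsum := hasSum_integral_iUnion (μ := ν) (fun _ : ℤ => measurableSet_Ioc)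
    (Set.pairwise_disjoint_Ioc_intCast ℝ) (integrable_squareWave_comp measurable_id).integrableOn
  rw [iUnion_Ioc_intCast, setIntegral_univ] at hsum
  exact hsum.congr_fun fun k => (setIntegral_squareWave_Ioc k).symm

end SquareWaveSeries

noncomputable section ExitCones

/-- The position of `z` relative to the barriers `x` and `y`, at the point `(z, x, y)`. It is
`0` when `z = x` and `1` when `z = y`. -/
def barrierRatio (p : ℝ × ℝ × ℝ) : ℝ := (p.1 - p.2.1) / (p.2.2 - p.2.1)

/-- The distribution of `barrierRatio` on the event that the barriers are on either side of the
origin, when the endpoint and the two barriers are independent standard normal variables. It is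
not normalised: its total mass is `1 / 4`. -/
def barrierLaw : Measure ℝ :=
  (stdNormal.prod ((stdNormal.prod stdNormal).restrict (Set.Iio 0 ×ˢ Set.Ioi 0))).map barrierRatio

lemma measurable_barrierRatio : Measurable barrierRatio := by
  unfold barrierRatio
  fun_prop

instance : IsFiniteMeasure barrierLaw := by
  unfold barrierLaw
  infer_instance

lemma ae_prod_fst_ne {α β : Type*} [MeasurableSpace α] [MeasurableSpace β]
    [MeasurableEq α] {μ : Measure α} {ν : Measure β} [SFinite μ] [SFinite ν]
    [NullSingletonClass μ] {g : β → α} (hg : Measurable g) :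
    ∀ᵐ p ∂μ.prod ν, p.1 ≠ g p.2 := by
  have hs : MeasurableSet {p : α × β | p.1 = g p.2} :=
    measurableSet_eq_fun measurable_fst (hg.comp measurable_snd)
  refine measure_eq_zero_iff_ae_notMem.1 ((Measure.prod_apply_symm hs).trans ?_)
  exact lintegral_eq_zero_of_ae_eq_zero (ae_of_all _ fun b => measure_singleton (g b))

instance : NullSingletonClass barrierLaw := by
  refine ⟨fun c => ?_⟩
  rw [barrierLaw, Measure.map_apply measurable_barrierRatio (measurableSet_singleton c),
    measure_eq_zero_iff_ae_notMem]
  have hline : Measurable fun q : ℝ × ℝ => c * (q.2 - q.1) + q.1 := by fun_prop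
  have hmem := ae_restrict_mem (μ := stdNormal.prod stdNormal)
    ((measurableSet_Iio (a := (0 : ℝ))).prod (measurableSet_Ioi (a := (0 : ℝ))))
  filter_upwards [ae_prod_fst_ne hline, Measure.quasiMeasurePreserving_snd.ae hmem]
    with p hp hneg hc
  have hpos : 0 < p.2.2 - p.2.1 := sub_pos.2 (hneg.1.trans hneg.2)
  rw [Set.mem_preimage, Set.mem_singleton_iff, barrierRatio, div_eq_iff hpos.ne'] at hc
  exact hp (sub_eq_iff_eq_add.1 hc)

lemma lt_barrierRatio_iff {p : ℝ × ℝ × ℝ} (hp : p.2 ∈ Set.Iio (0 : ℝ) ×ˢ Set.Ioi (0 : ℝ)) {k : ℝ} :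
    k < barrierRatio p ↔ 0 < dot3 (1, k - 1, -k) p := by
  rw [barrierRatio, lt_div_iff₀ (sub_pos.2 (hp.1.trans hp.2)), ← sub_pos, dot3]
  ring_nf

lemma measureReal_barrierLaw_Ioi (k : ℝ) : barrierLaw.real (Set.Ioi k) =
    -1 / 8 + (Real.arccos ((k - 1) / √(2 * (k * (k - 1) + 1)))
      + Real.arccos (k / √(2 * (k * (k - 1) + 1)))) / (4 * Real.pi) := by
  have hset : {p : ℝ × ℝ × ℝ | p.2 ∈ Set.Iio (0 : ℝ) ×ˢ Set.Ioi (0 : ℝ) ∧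
      p ∈ barrierRatio ⁻¹' Set.Ioi k} =
      {p | 0 < dot3 (0, -1, 0) p ∧ 0 < dot3 (0, 0, 1) p ∧ 0 < dot3 (1, k - 1, -k) p} := by
    ext p
    refine (and_congr_right fun hp => lt_barrierRatio_iff hp).trans ?_
    simp [dot3, and_assoc]
  have hnorm : dot3 (1, k - 1, -k) (1, k - 1, -k) = 2 * (k * (k - 1) + 1) := by
    simp only [dot3]
    ring
  have hleft : dot3 (0, -1, 0) (1, k - 1, -k) = -(k - 1) := by simp [dot3]
  have hright : dot3 (0, 0, 1) (1, k - 1, -k) = -k := by simp [dot3]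
  rw [barrierLaw, map_measureReal_apply measurable_barrierRatio measurableSet_Ioi,
    measureReal_prod_restrict _ (measurable_barrierRatio measurableSet_Ioi), hset,
    measureReal_stdNormal3_three_halfSpaces (by simp) (by simp) (by simp), hnorm, hleft, hright]
  simp only [dot3, mul_zero, mul_one, mul_neg, add_zero, zero_add, zero_div,
    Real.arccos_zero, neg_neg, one_mul, neg_div, Real.arccos_neg]
  field_simp
  ring

lemma measureReal_barrierLaw_Ioi_neg (k : ℝ) :
    barrierLaw.real (Set.Ioi (-k)) = 1 / 4 - barrierLaw.real (Set.Ioi (k + 1)) := by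
  have hnorm : 2 * (-k * (-k - 1) + 1) = 2 * ((k + 1) * (k + 1 - 1) + 1) := by ring
  rw [measureReal_barrierLaw_Ioi, measureReal_barrierLaw_Ioi, hnorm, ← neg_add', neg_div _ (k + 1),
    neg_div _ k, Real.arccos_neg, Real.arccos_neg, add_sub_cancel_right]
  field_simp
  ring

lemma measureReal_barrierLaw_Ioi_one : barrierLaw.real (Set.Ioi 1) = 1 / 16 := by
  rw [measureReal_barrierLaw_Ioi, sub_self, mul_zero, zero_add, mul_one, zero_div,
    Real.arccos_zero, arccos_one_div_sqrt_two]
  field_simp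
  ring

lemma measureReal_barrierLaw_Ioi_sub (n : ℕ) :
    barrierLaw.real (Set.Ioi (n + 1 : ℝ)) - barrierLaw.real (Set.Ioi (n + 2 : ℝ)) =
      arccosBracket n / (4 * Real.pi) := by
  rw [measureReal_barrierLaw_Ioi, measureReal_barrierLaw_Ioi, arccosBracket]
  ring_nf

lemma measureReal_barrierLaw_zpow_pair (n : ℕ) :
    (-1 : ℝ) ^ (n + 1 : ℤ) * (barrierLaw.real (Set.Ioi (n + 1 : ℝ))
        - barrierLaw.real (Set.Ioi (n + 1 + 1 : ℝ)))
      + (-1) ^ (-(n + 1) : ℤ) * (barrierLaw.real (Set.Ioi (-(n + 1) : ℝ))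
        - barrierLaw.real (Set.Ioi (-(n + 1) + 1 : ℝ))) =
      -(2 * Real.pi)⁻¹ * ((-1) ^ n * arccosBracket n) := by
  have hsign : (-1 : ℝ) ^ (n + 1 : ℤ) = -(-1) ^ n := by
    rw [zpow_add_one₀ (by norm_num), zpow_natCast, mul_neg_one]
  have hsign' : (-1 : ℝ) ^ (-(n + 1) : ℤ) = -(-1) ^ n := by
    rw [zpow_neg, ← inv_zpow, inv_neg_one, hsign]
  have hshift : -(n + 1 : ℝ) + 1 = -n := by ring
  have hneg := measureReal_barrierLaw_Ioi_neg (n + 1)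
  have hneg' := measureReal_barrierLaw_Ioi_neg n
  have hbracket := measureReal_barrierLaw_Ioi_sub n
  rw [add_assoc, one_add_one_eq_two] at hneg ⊢
  rw [hsign, hsign', hshift, hneg, hneg']
  linear_combination (-2 * (-1 : ℝ) ^ n) * hbracket

/- By the symmetry of `barrierLaw` about `1 / 2`, the terms `k = n + 1` and `k = -(n + 1)` of
the series for the square wave coincide. -/
lemma hasSum_arccosBracket :
    HasSum (fun n : ℕ => (-1 : ℝ) ^ n * arccosBracket n)
      (2 * Real.pi * (1 / 8 - ∫ u, squareWave u ∂barrierLaw)) := by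
  have hpaired := ((hasSum_nat_add_iff' 1).2
    (hasSum_integral_squareWave (ν := barrierLaw)).nat_add_neg).mul_left (-(2 * Real.pi))
  have hzero := measureReal_barrierLaw_Ioi_neg 0
  rw [neg_zero, zero_add, measureReal_barrierLaw_Ioi_one] at hzero
  refine (congrArg (HasSum _) ?_).mp (hpaired.congr_fun fun n => ?_)
  · simp only [Finset.sum_range_one, Nat.cast_zero, Int.cast_zero, neg_zero, zpow_zero, zero_add,
      hzero, measureReal_barrierLaw_Ioi_one]
    ring
  · push_cast
    rw [measureReal_barrierLaw_zpow_pair]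
    field_simp

lemma integrable_squareWave_barrierRatio {ν : Measure (ℝ × ℝ)} [IsFiniteMeasure ν] :
    Integrable (fun p : ℝ × ℝ × ℝ => squareWave ((p.1 - p.2.1) / (p.2.2 - p.2.1)))
      (stdNormal.prod ν) :=
  integrable_squareWave_comp measurable_barrierRatio

lemma integral_squareWave_barrierLaw : ∫ u, squareWave u ∂barrierLaw =
    ∫ q in Set.Iio 0 ×ˢ Set.Ioi 0, ∫ z, squareWave ((z - q.1) / (q.2 - q.1)) ∂stdNormal
      ∂stdNormal.prod stdNormal := by
  rw [barrierLaw, integral_map measurable_barrierRatio.aemeasurable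
    measurable_squareWave.aestronglyMeasurable]
  exact integral_prod_symm _ integrable_squareWave_barrierRatio

variable {Ω : Type*} [MeasurableSpace Ω] {P : Measure Ω} {W : ℝ≥0 → Ω → ℝ}

lemma IsRegularBrownian.meanJointCdf_runningMax_runningMin (hW : IsRegularBrownian W P) :
    meanJointCdf P (runningMax W 1) (runningMin W 1) =
      1 / 2 - 4 * ∫ u, squareWave u ∂barrierLaw := by
  have := hW.isProbabilityMeasure
  have : NullSingletonClass (P.map (runningMax W 1)) :=
    hW.nullSingletonClass_map_wienerTriple one_ne_zero 1
  have : IsProbabilityMeasure (P.map (runningMax W 1)) :=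
    Measure.isProbabilityMeasure_map (hW.measurable_runningMax 1).aemeasurable
  have hmin : Measurable (runningMin W 1) := hW.measurable_wienerTriple 1 2
  have : IsProbabilityMeasure (P.map (runningMin W 1)) :=
    Measure.isProbabilityMeasure_map hmin.aemeasurable
  let ν : Measure (ℝ × ℝ) := (stdNormal.prod stdNormal).restrict (Set.Iio 0 ×ˢ Set.Ioi 0)
  have hlaw : (P.map (runningMin W 1)).prod (P.map (runningMax W 1)) = (4 : ℝ≥0) • ν := by
    rw [hW.map_runningMin one_ne_zero, hW.map_runningMax one_ne_zero, Measure.prod_smul_left,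
      Measure.prod_smul_right, Measure.prod_restrict, smul_smul]
    norm_num [ν]
  have hcdf : ∫ p, cdf (P.map (runningMax W 1)) p.2
      ∂(P.map (runningMin W 1)).prod (P.map (runningMax W 1)) = 1 / 2 := by
    rw [integral_fun_snd, probReal_univ, one_smul, integral_cdf]
  have hcdf_int : Integrable (fun p : ℝ × ℝ => cdf (P.map (runningMax W 1)) p.2) ν :=
    integrable_of_mem_Icc_zero_one ((monotone_cdf _).measurable.comp measurable_snd)
      fun _ => ⟨cdf_nonneg _ _, cdf_le_one _ _⟩
  have hsides : ∀ᵐ p ∂ν, p.1 < 0 ∧ 0 < p.2 :=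
    ae_restrict_mem (measurableSet_Iio.prod measurableSet_Ioi)
  rw [hlaw, integral_smul_nnreal_measure] at hcdf
  rw [meanJointCdf_eq_integral_prod (hW.measurable_runningMax 1) hmin, hlaw,
    integral_smul_nnreal_measure, integral_congr_ae (hsides.mono fun p hp =>
      hW.measureReal_runningMax_le_runningMin_le one_ne_zero hp.1 hp.2),
    integral_sub hcdf_int integrable_squareWave_barrierRatio.integral_prod_right,
    smul_sub, hcdf, integral_squareWave_barrierLaw, NNReal.smul_def, smul_eq_mul,
    NNReal.coe_ofNat]

end ExitCones

section ArcsinBounds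

lemma le_of_hasDerivAt_le {f g f' g' : ℝ → ℝ} (hf : ∀ x, HasDerivAt f (f' x) x)
    (hg : ∀ x, HasDerivAt g (g' x) x) (h0 : f 0 ≤ g 0) (hle : ∀ x, 0 ≤ x → f' x ≤ g' x)
    {x : ℝ} (hx : 0 ≤ x) : f x ≤ g x := by
  have hmono : MonotoneOn (g - f) (Set.Ici 0) :=
    monotoneOn_of_hasDerivWithinAt_nonneg (convex_Ici 0)
      (fun y _ => ((hg y).sub (hf y)).continuousAt.continuousWithinAt)
      (fun y _ => ((hg y).sub (hf y)).hasDerivWithinAt)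
      fun y hy => sub_nonneg.2 (hle y (interior_subset hy))
  exact sub_nonneg.1 ((sub_nonneg.2 h0).trans (hmono Set.self_mem_Ici hx hx))

lemma cos_le_quartic {x : ℝ} (hx : 0 ≤ x) : Real.cos x ≤ 1 - x ^ 2 / 2 + x ^ 4 / 24 := by
  refine le_of_hasDerivAt_le (g := fun y => 1 - y ^ 2 / 2 + y ^ 4 / 24) Real.hasDerivAt_cos
    (fun y => ?_) (by simp) (fun y hy => neg_le_neg (Real.sin_ge_sub_cube hy)) hx
  refine (((hasDerivAt_pow 2 y).div_const 2).const_sub 1 |>.add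
    ((hasDerivAt_pow 4 y).div_const 24)).congr_deriv ?_
  norm_num
  ring

lemma sin_le_quintic {x : ℝ} (hx : 0 ≤ x) : Real.sin x ≤ x - x ^ 3 / 6 + x ^ 5 / 120 := by
  refine le_of_hasDerivAt_le (g := fun y => y - y ^ 3 / 6 + y ^ 5 / 120) Real.hasDerivAt_sin
    (fun y => ?_) (by simp) (fun y hy => cos_le_quartic hy) hx
  refine (((hasDerivAt_id y).sub ((hasDerivAt_pow 3 y).div_const 6)).add
    ((hasDerivAt_pow 5 y).div_const 120)).congr_deriv ?_
  norm_num
  ring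

lemma sextic_le_cos {x : ℝ} (hx : 0 ≤ x) :
    1 - x ^ 2 / 2 + x ^ 4 / 24 - x ^ 6 / 720 ≤ Real.cos x := by
  refine le_of_hasDerivAt_le (f := fun y => 1 - y ^ 2 / 2 + y ^ 4 / 24 - y ^ 6 / 720)
    (fun y => ?_) Real.hasDerivAt_cos (by simp) (fun y hy => neg_le_neg (sin_le_quintic hy)) hx
  refine ((((hasDerivAt_pow 2 y).div_const 2).const_sub 1 |>.add
    ((hasDerivAt_pow 4 y).div_const 24)).sub
      ((hasDerivAt_pow 6 y).div_const 720)).congr_deriv ?_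
  norm_num
  ring

lemma septic_le_sin {x : ℝ} (hx : 0 ≤ x) :
    x - x ^ 3 / 6 + x ^ 5 / 120 - x ^ 7 / 5040 ≤ Real.sin x := by
  refine le_of_hasDerivAt_le (f := fun y => y - y ^ 3 / 6 + y ^ 5 / 120 - y ^ 7 / 5040)
    (fun y => ?_) Real.hasDerivAt_sin (by simp) (fun y hy => sextic_le_cos hy) hx
  refine ((((hasDerivAt_id y).sub ((hasDerivAt_pow 3 y).div_const 6)).add
    ((hasDerivAt_pow 5 y).div_const 120)).sub
      ((hasDerivAt_pow 7 y).div_const 5040)).congr_deriv ?_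
  norm_num
  ring

lemma le_arcsin_of_sin_le {a s : ℝ} (ha : a ∈ Set.Icc (0 : ℝ) 1) (h : Real.sin a ≤ s) :
    a ≤ Real.arcsin s := by
  have hpi := Real.pi_gt_three
  exact (Real.le_arcsin_iff_sin_le' ⟨by linarith [ha.1], by linarith [ha.2]⟩).2 h

lemma arcsin_le_of_le_sin {b s : ℝ} (hb : b ∈ Set.Icc (0 : ℝ) 1) (h : s ≤ Real.sin b) :
    Real.arcsin s ≤ b := by
  have hpi := Real.pi_gt_three
  exact (Real.arcsin_le_iff_le_sin' ⟨by linarith [hb.1], by linarith [hb.2]⟩).2 h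

lemma arcsin_mem_Icc {a b s : ℝ} (ha : a ∈ Set.Icc (0 : ℝ) 1) (hb : b ∈ Set.Icc (0 : ℝ) 1)
    (has : a - a ^ 3 / 6 + a ^ 5 / 120 ≤ s)
    (hsb : s ≤ b - b ^ 3 / 6 + b ^ 5 / 120 - b ^ 7 / 5040) :
    Real.arcsin s ∈ Set.Icc a b :=
  ⟨le_arcsin_of_sin_le ha ((sin_le_quintic ha.1).trans has),
    arcsin_le_of_le_sin hb (hsb.trans (septic_le_sin hb.1))⟩

end ArcsinBounds

noncomputable section AngleExcess

/-- The amount by which the two angles at level `x` in `arccosBracket` exceed a right angle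
together; the brackets are its successive differences. -/
def angleExcess (x : ℝ) : ℝ :=
  Real.arccos (x / √(2 * (x * (x + 1) + 1))) + Real.arccos ((x + 1) / √(2 * (x * (x + 1) + 1)))
    - Real.pi / 2

lemma arccosBracket_eq (n : ℕ) : arccosBracket n = angleExcess n - angleExcess (n + 1) := by
  rw [arccosBracket, angleExcess, angleExcess]
  ring_nf

lemma angleExcess_zero : angleExcess 0 = Real.pi / 4 := by
  rw [angleExcess, zero_div, Real.arccos_zero, zero_mul, zero_add, mul_one,
    arccos_one_div_sqrt_two]
  ring

lemma angleExcess_eq_arcsin {x p : ℝ} (hx : 0 ≤ x) (hp : p = x * (x + 1) + 1) :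
    angleExcess x = Real.arcsin ((1 + √(p ^ 2 + 1) - p) / (2 * p)) := by
  have hp1 : 1 ≤ p := by rw [hp]; nlinarith
  have hs : 0 < √(2 * p) := by positivity
  have hs2 : √(2 * p) ^ 2 = 2 * p := Real.sq_sqrt (by positivity)
  set A := Real.arccos (x / √(2 * p))
  set B := Real.arccos ((x + 1) / √(2 * p))
  have hA : A ∈ Set.Icc 0 (Real.pi / 2) :=
    ⟨Real.arccos_nonneg _, Real.arccos_le_pi_div_two.2 (by positivity)⟩
  have hB : B ∈ Set.Icc 0 (Real.pi / 2) :=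
    ⟨Real.arccos_nonneg _, Real.arccos_le_pi_div_two.2 (by positivity)⟩
  have hcosA : Real.cos A = x / √(2 * p) :=
    Real.cos_arccos (neg_one_lt_zero.le.trans (by positivity))
      ((div_le_one hs).2 (Real.le_sqrt_of_sq_le (by rw [hp]; nlinarith)))
  have hcosB : Real.cos B = (x + 1) / √(2 * p) :=
    Real.cos_arccos (neg_one_lt_zero.le.trans (by positivity))
      ((div_le_one hs).2 (Real.le_sqrt_of_sq_le (by rw [hp]; nlinarith)))
  have hfactor : (Real.sin A * Real.sin B) ^ 2 = (p ^ 2 + 1) / (2 * p) ^ 2 := by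
    rw [mul_pow, Real.sin_sq, Real.sin_sq, hcosA, hcosB, div_pow, div_pow, hs2, hp]
    field_simp
    ring
  have hsin : Real.sin A * Real.sin B = √(p ^ 2 + 1) / (2 * p) := by
    rw [← Real.sqrt_sq (by positivity : 0 ≤ 2 * p), ← Real.sqrt_div (by positivity), ← hfactor]
    exact (Real.sqrt_sq (mul_nonneg
      (Real.sin_nonneg_of_nonneg_of_le_pi hA.1 (Real.arccos_le_pi _))
      (Real.sin_nonneg_of_nonneg_of_le_pi hB.1 (Real.arccos_le_pi _)))).symm
  have hsum : Real.sin (A + B - Real.pi / 2) = (1 + √(p ^ 2 + 1) - p) / (2 * p) := by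
    rw [Real.sin_sub_pi_div_two, Real.cos_add, hcosA, hcosB, hsin, div_mul_div_comm, ← sq, hs2,
      show x * (x + 1) = p - 1 by rw [hp]; ring]
    ring
  rw [← hsum, Real.arcsin_sin (by linarith [hA.1, hB.1]) (by linarith [hA.2, hB.2]),
    angleExcess, ← hp]

lemma angleExcess_mem_Icc {x p a b r₁ r₂ : ℝ} (hx : 0 ≤ x) (hp : p = x * (x + 1) + 1)
    (ha : a ∈ Set.Icc (0 : ℝ) 1) (hb : b ∈ Set.Icc (0 : ℝ) 1)
    (hr₁ : r₁ ^ 2 ≤ p ^ 2 + 1) (hr₂_nonneg : 0 ≤ r₂) (hr₂ : p ^ 2 + 1 ≤ r₂ ^ 2)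
    (har : a - a ^ 3 / 6 + a ^ 5 / 120 ≤ (1 + r₁ - p) / (2 * p))
    (hbr : (1 + r₂ - p) / (2 * p) ≤ b - b ^ 3 / 6 + b ^ 5 / 120 - b ^ 7 / 5040) :
    angleExcess x ∈ Set.Icc a b := by
  have hp0 : 0 < p := by rw [hp]; positivity
  rw [angleExcess_eq_arcsin hx hp]
  refine arcsin_mem_Icc ha hb (har.trans ?_) (le_trans ?_ hbr) <;> gcongr
  · exact Real.le_sqrt_of_sq_le hr₁
  · exact Real.sqrt_le_iff.2 ⟨hr₂_nonneg, hr₂⟩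

/-- An approximation of `angleExcess`. Since `(x ^ 2 + 1) * ((x + 1) ^ 2 + 1) = p ^ 2 + 1` for
`p = x * (x + 1) + 1`, its sum over `x` and `x + 1` is a simple function of `p` and is close to
`2 * angleExcess x`; adding it to the partial sums of the alternating series therefore makes these
nearly constant. -/
def angleExcessApprox (x : ℝ) : ℝ := 1 / (2 * (x ^ 2 + 1))

lemma angleExcessApprox_add {x p : ℝ} (hp : p = x * (x + 1) + 1) :
    angleExcessApprox x + angleExcessApprox (x + 1)
      = p / (p ^ 2 + 1) + 1 / (2 * (p ^ 2 + 1)) := by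
  have hfactor : p ^ 2 + 1 = (x ^ 2 + 1) * ((x + 1) ^ 2 + 1) := by rw [hp]; ring
  rw [hfactor, hp, angleExcessApprox, angleExcessApprox]
  field_simp
  ring

lemma angleExcessApprox_add_le {x : ℝ} (hx : 0 ≤ x) :
    angleExcessApprox x + angleExcessApprox (x + 1) ≤ 2 * angleExcess x := by
  obtain ⟨p, hp⟩ : ∃ p, p = x * (x + 1) + 1 := ⟨_, rfl⟩
  have hp1 : 1 ≤ p := by rw [hp]; nlinarith
  have hsqrt : p + p / (2 * p ^ 2 + 1) ≤ √(p ^ 2 + 1) := by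
    refine Real.le_sqrt_of_sq_le ?_
    rw [← sub_nonneg, show p ^ 2 + 1 - (p + p / (2 * p ^ 2 + 1)) ^ 2
      = (p ^ 2 + 1) / (2 * p ^ 2 + 1) ^ 2 by field_simp; ring]
    positivity
  have harcsin : (1 / p + 1 / (2 * p ^ 2 + 1)) / 2 ≤ angleExcess x := by
    rw [angleExcess_eq_arcsin hx hp]
    have hle : 1 / p + 1 / (2 * p ^ 2 + 1) ≤ 1 + 1 := by
      gcongr
      · exact div_le_one_of_le₀ hp1 (by positivity)
      · exact div_le_one_of_le₀ (by nlinarith) (by positivity)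
    refine le_arcsin_of_sin_le ⟨by positivity, by linarith⟩
      ((Real.sin_le (by positivity)).trans ?_)
    calc (1 / p + 1 / (2 * p ^ 2 + 1)) / 2
        = (1 + (p + p / (2 * p ^ 2 + 1)) - p) / (2 * p) := by field_simp; ring
      _ ≤ (1 + √(p ^ 2 + 1) - p) / (2 * p) := by gcongr
  have hfirst : p / (p ^ 2 + 1) ≤ 1 / p := by
    rw [div_le_div_iff₀ (by positivity) (by positivity)]
    nlinarith
  have hsecond : 1 / (2 * (p ^ 2 + 1)) ≤ 1 / (2 * p ^ 2 + 1) := by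
    gcongr
    linarith
  rw [angleExcessApprox_add hp]
  linarith

lemma two_mul_angleExcess_le {x p : ℝ} (hx : 0 ≤ x) (hp : p = x * (x + 1) + 1) (hp10 : 10 ≤ p) :
    2 * angleExcess x ≤ angleExcessApprox x + angleExcessApprox (x + 1) + 9 / 8 / p ^ 3 := by
  obtain ⟨q, hq⟩ : ∃ q, q = 1 / p := ⟨_, rfl⟩
  have hpq : p = 1 / q := by rw [hq, one_div_one_div]
  have hq0 : 0 < q := by rw [hq]; positivity
  have hq10 : q ≤ 1 / 10 := by rw [hq]; gcongr
  have hsqrt : √(p ^ 2 + 1) ≤ p + q / 2 := by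
    refine Real.sqrt_le_iff.2 ⟨by positivity, ?_⟩
    have : p * q = 1 := by rw [hpq]; field_simp
    nlinarith [sq_nonneg q]
  have harcsin : angleExcess x ≤ q / 2 + q ^ 2 / 4 + q ^ 3 / 32 := by
    rw [angleExcess_eq_arcsin hx hp]
    set b := q / 2 + q ^ 2 / 4 + q ^ 3 / 32 with hb
    have hbq : b ≤ 11 / 20 * q := by nlinarith [sq_nonneg q]
    have hb0 : 0 ≤ b := by positivity
    refine arcsin_le_of_le_sin ⟨hb0, by linarith⟩ (le_trans ?_ (Real.sin_ge_sub_cube hb0))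
    calc (1 + √(p ^ 2 + 1) - p) / (2 * p) ≤ (1 + (p + q / 2) - p) / (2 * p) := by gcongr
      _ = b - q ^ 3 / 32 := by rw [hb, hpq]; field_simp; ring
      _ ≤ b - (11 / 20 * q) ^ 3 / 6 := by nlinarith [pow_pos hq0 3]
      _ ≤ b - b ^ 3 / 6 := by gcongr
  have hfirst : q - q ^ 3 ≤ p / (p ^ 2 + 1) := by
    rw [le_div_iff₀ (by positivity), hpq, ← sub_nonneg]
    field_simp
    ring_nf
    positivity
  have hsecond : q ^ 2 / 2 - q ^ 4 / 2 ≤ 1 / (2 * (p ^ 2 + 1)) := by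
    rw [le_div_iff₀ (by positivity), hpq, ← sub_nonneg]
    field_simp
    ring_nf
    positivity
  have hcube : 9 / 8 / p ^ 3 = 9 / 8 * q ^ 3 := by rw [hpq]; field_simp
  rw [angleExcessApprox_add hp, hcube]
  nlinarith [mul_le_mul_of_nonneg_left hq10 (pow_pos hq0 3).le]

lemma five_div_cube_le_sub {x : ℝ} (hx : 0 < x) :
    5 / (x * (x + 1) + 1) ^ 3 ≤ 1 / x ^ 5 - 1 / (x + 1) ^ 5 := by
  have hm : 0 < x * (x + 1) := by positivity
  rw [div_sub_div _ _ (by positivity) (by positivity), div_le_div_iff₀ (by positivity)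
    (by positivity), ← sub_nonneg, ← mul_pow, show 1 * (x + 1) ^ 5 - x ^ 5 * 1
      = 5 * (x * (x + 1)) ^ 2 + 5 * (x * (x + 1)) + 1 by ring]
  generalize x * (x + 1) = m at hm ⊢
  ring_nf
  positivity

lemma abs_two_mul_angleExcess_sub_le {x : ℝ} (hx : 3 ≤ x) :
    |2 * angleExcess x - (angleExcessApprox x + angleExcessApprox (x + 1))|
      ≤ 9 / 40 / x ^ 5 - 9 / 40 / (x + 1) ^ 5 := by
  have hlower := angleExcessApprox_add_le (by linarith : 0 ≤ x)
  have hupper := two_mul_angleExcess_le (by linarith : 0 ≤ x) rfl (by nlinarith)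
  have htail := five_div_cube_le_sub (by linarith : 0 < x)
  rw [abs_of_nonneg (sub_nonneg.2 hlower)]
  calc 2 * angleExcess x - (angleExcessApprox x + angleExcessApprox (x + 1))
      ≤ 9 / 8 / (x * (x + 1) + 1) ^ 3 := by linarith
    _ = 9 / 40 * (5 / (x * (x + 1) + 1) ^ 3) := by ring
    _ ≤ 9 / 40 * (1 / x ^ 5 - 1 / (x + 1) ^ 5) := by gcongr
    _ = 9 / 40 / x ^ 5 - 9 / 40 / (x + 1) ^ 5 := by ring

end AngleExcess

section Numerics

open Filter Topology

lemma abs_sub_le_of_abs_succ_sub_le {u d : ℕ → ℝ} {l : ℝ} {N : ℕ}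
    (hu : Tendsto u atTop (𝓝 l)) (hd : ∀ n, N ≤ n → 0 ≤ d n)
    (h : ∀ n, N ≤ n → |u (n + 1) - u n| ≤ d n - d (n + 1)) : |l - u N| ≤ d N := by
  have hstep : ∀ n, N ≤ n → |u n - u N| ≤ d N - d n := fun n hn => by
    induction n, hn using Nat.le_induction with
    | base => simp
    | succ n hn ih => linarith [h n hn, abs_sub_le (u (n + 1)) (u n) (u N)]
  refine le_of_tendsto (hu.sub_const (u N)).abs ?_
  filter_upwards [eventually_ge_atTop N] with n hn
  linarith [hstep n hn, hd n hn]

lemma tendsto_angleExcessApprox : Tendsto angleExcessApprox atTop (𝓝 0) :=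
  tendsto_const_nhds.div_atTop ((tendsto_atTop_add_const_right _ 1
    (tendsto_pow_atTop two_ne_zero)).const_mul_atTop two_pos)

lemma tendsto_angleExcess_sub_approx :
    Tendsto (fun x => angleExcess x - angleExcessApprox x) atTop (𝓝 0) := by
  have hsucc : Tendsto (fun x => angleExcessApprox (x + 1)) atTop (𝓝 0) :=
    tendsto_angleExcessApprox.comp (tendsto_atTop_add_const_right _ 1 tendsto_id)
  have hpow : Tendsto (fun x : ℝ => 9 / 40 / x ^ 5) atTop (𝓝 0) :=
    tendsto_const_nhds.div_atTop (tendsto_pow_atTop (by norm_num))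
  have hdiff : Tendsto (fun x => 2 * angleExcess x
      - (angleExcessApprox x + angleExcessApprox (x + 1))) atTop (𝓝 0) := by
    refine squeeze_zero_norm' ?_ hpow
    filter_upwards [eventually_ge_atTop 3] with x hx
    refine (abs_two_mul_angleExcess_sub_le hx).trans (sub_le_self _ ?_)
    positivity
  convert ((hdiff.add hsucc).sub tendsto_angleExcessApprox).div_const 2 using 1
  · ext x
    ring
  · norm_num

lemma abs_sub_sum_arccosBracket_le {l : ℝ}
    (hl : HasSum (fun n : ℕ => (-1 : ℝ) ^ n * arccosBracket n) l) {N : ℕ} (hN : 3 ≤ N) :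
    |l - (∑ n ∈ Finset.range N, (-1 : ℝ) ^ n * arccosBracket n
        - (-1) ^ N * (angleExcess N - angleExcessApprox N))| ≤ 9 / 40 / N ^ 5 := by
  have hzero : Tendsto (fun n : ℕ => (-1 : ℝ) ^ n * (angleExcess n - angleExcessApprox n))
      atTop (𝓝 0) := by
    refine squeeze_zero_norm (fun n => ?_)
      (by simpa using (tendsto_angleExcess_sub_approx.comp tendsto_natCast_atTop_atTop).norm)
    rw [norm_mul, norm_pow, norm_neg, norm_one, one_pow, one_mul]
    exact le_rfl
  refine abs_sub_le_of_abs_succ_sub_le (u := fun N : ℕ => ∑ n ∈ Finset.range N,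
    (-1 : ℝ) ^ n * arccosBracket n - (-1) ^ N * (angleExcess N - angleExcessApprox N))
    (d := fun N : ℕ => 9 / 40 / (N : ℝ) ^ 5) (by simpa using hl.tendsto_sum_nat.sub hzero)
    (fun n _ => by positivity) fun n hn => ?_
  rw [Finset.sum_range_succ, arccosBracket_eq, Nat.cast_succ]
  convert abs_two_mul_angleExcess_sub_le (x := n) (mod_cast hN.trans hn) using 1
  refine Eq.trans ?_ (by rw [abs_mul, abs_neg_one_pow, one_mul] :
    |(-1) ^ n * (2 * angleExcess n - (angleExcessApprox n + angleExcessApprox (n + 1)))| = _)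
  ring_nf

lemma abs_sum_arccosBracket_sub_le :
    |∑ n ∈ Finset.range 14, (-1 : ℝ) ^ n * arccosBracket n
      - (-1) ^ 14 * (angleExcess 14 - angleExcessApprox 14)
      - (Real.pi / 4 - 0.2871298)| ≤ 0.00000014 := by
  have h1 : angleExcess 1 ∈ Set.Icc 0.19494537 0.19494538 := by
    apply angleExcess_mem_Icc (p := 3) (r₁ := 3.16227766) (r₂ := 3.16227767) <;> norm_num
  have h2 : angleExcess 2 ∈ Set.Icc 0.07657967 0.07657968 := by
    apply angleExcess_mem_Icc (p := 7) (r₁ := 7.07106781) (r₂ := 7.07106782) <;> norm_num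
  have h3 : angleExcess 3 ∈ Set.Icc 0.03994927 0.03994928 := by
    apply angleExcess_mem_Icc (p := 13) (r₁ := 13.03840481) (r₂ := 13.03840482) <;> norm_num
  have h4 : angleExcess 4 ∈ Set.Icc 0.02437851 0.02437852 := by
    apply angleExcess_mem_Icc (p := 21) (r₁ := 21.02379604) (r₂ := 21.02379605) <;> norm_num
  have h5 : angleExcess 5 ∈ Set.Icc 0.01638984 0.01638985 := by
    apply angleExcess_mem_Icc (p := 31) (r₁ := 31.01612483) (r₂ := 31.01612484) <;> norm_num
  have h6 : angleExcess 6 ∈ Set.Icc 0.01176336 0.01176337 := by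
    apply angleExcess_mem_Icc (p := 43) (r₁ := 43.01162633) (r₂ := 43.01162634) <;> norm_num
  have h7 : angleExcess 7 ∈ Set.Icc 0.00884898 0.00884899 := by
    apply angleExcess_mem_Icc (p := 57) (r₁ := 57.00877125) (r₂ := 57.00877126) <;> norm_num
  have h8 : angleExcess 8 ∈ Set.Icc 0.00689628 0.00689629 := by
    apply angleExcess_mem_Icc (p := 73) (r₁ := 73.00684899) (r₂ := 73.006849) <;> norm_num
  have h9 : angleExcess 9 ∈ Set.Icc 0.00552472 0.00552473 := by
    apply angleExcess_mem_Icc (p := 91) (r₁ := 91.00549433) (r₂ := 91.00549434) <;> norm_num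
  have h10 : angleExcess 10 ∈ Set.Icc 0.00452481 0.00452482 := by
    apply angleExcess_mem_Icc (p := 111) (r₁ := 111.00450441) (r₂ := 111.00450442) <;> norm_num
  have h11 : angleExcess 11 ∈ Set.Icc 0.00377354 0.00377355 := by
    apply angleExcess_mem_Icc (p := 133) (r₁ := 133.00375934) (r₂ := 133.00375935) <;> norm_num
  have h12 : angleExcess 12 ∈ Set.Icc 0.00319486 0.00319487 := by
    apply angleExcess_mem_Icc (p := 157) (r₁ := 157.00318468) (r₂ := 157.00318469) <;> norm_num
  have h13 : angleExcess 13 ∈ Set.Icc 0.0027397 0.00273971 := by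
    apply angleExcess_mem_Icc (p := 183) (r₁ := 183.00273222) (r₂ := 183.00273223) <;> norm_num
  simp only [Set.mem_Icc] at *
  have htelescope : ∑ n ∈ Finset.range 14, (-1 : ℝ) ^ n * arccosBracket n = Real.pi / 4
      - 2 * (angleExcess 1 - angleExcess 2 + angleExcess 3 - angleExcess 4 + angleExcess 5
        - angleExcess 6 + angleExcess 7 - angleExcess 8 + angleExcess 9 - angleExcess 10
        + angleExcess 11 - angleExcess 12 + angleExcess 13) + angleExcess 14 := by
    norm_num [Finset.sum_range_succ, arccosBracket_eq, angleExcess_zero]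
    ring
  rw [htelescope, angleExcessApprox, abs_le]
  constructor <;> linarith

theorem abs_tsum_arccosBracket_sub_value_lt :
    |24 / Real.pi * (∑' n : ℕ, (-1 : ℝ) ^ n * arccosBracket n) - 3 - 0.80649| < 0.000005 := by
  have htail := abs_le.1 (abs_sub_sum_arccosBracket_le hasSum_arccosBracket.summable.hasSum
    (N := 14) (by norm_num))
  have hpartial := abs_le.1 abs_sum_arccosBracket_sub_le
  set S := ∑' n : ℕ, (-1 : ℝ) ^ n * arccosBracket n
  have hpi_gt := Real.pi_gt_d20
  have hpi_lt := Real.pi_lt_d20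
  rw [show 24 / Real.pi * S - 3 - 0.80649 = (24 * S - 3.80649 * Real.pi) / Real.pi by
    field_simp; ring, abs_div, abs_of_pos Real.pi_pos, div_lt_iff₀ Real.pi_pos, abs_lt]
  norm_num at htail hpartial
  constructor <;> linarith

theorem abs_two_sub_arccos_sub_value_lt :
    |2 - 6 / Real.pi * Real.arccos (√6 / 3) - 0.8245| < 0.00005 := by
  have hpi_gt := Real.pi_gt_d20
  have hpi_lt := Real.pi_lt_d20
  have hsq : √3 ^ 2 = 3 := Real.sq_sqrt (by norm_num)
  have harcsin : Real.arccos (√6 / 3) = Real.arcsin (1 / √3) := by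
    rw [Real.arccos_eq_arcsin (by positivity), div_pow, Real.sq_sqrt (by norm_num),
      show (1 : ℝ) - 6 / 3 ^ 2 = 1 / 3 by norm_num, Real.sqrt_div zero_le_one, Real.sqrt_one]
  have hlower : 0.57735026 ≤ 1 / √3 := by
    rw [le_div_iff₀ (by positivity)]
    nlinarith
  have hupper : 1 / √3 ≤ 0.57735028 := by
    rw [div_le_iff₀ (by positivity)]
    nlinarith [Real.sqrt_nonneg 3]
  have hmem : Real.arcsin (1 / √3) ∈ Set.Icc 0.61547 0.6155 :=
    arcsin_mem_Icc (by norm_num) (by norm_num) (le_trans (by norm_num) hlower)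
      (hupper.trans (by norm_num))
  rw [harcsin, show 2 - 6 / Real.pi * Real.arcsin (1 / √3) - 0.8245
      = (1.1755 * Real.pi - 6 * Real.arcsin (1 / √3)) / Real.pi by field_simp; ring, abs_div,
    abs_of_pos Real.pi_pos, div_lt_iff₀ Real.pi_pos, abs_lt]
  constructor <;> linarith [hmem.1, hmem.2]

end Numerics

lemma marginWM_eq_insertNth (C : (Fin 3 → ℝ) → ℝ) :
    marginWM C = fun p => C ((2 : Fin 3).insertNth (1 : ℝ) p) := by
  funext p
  exact congrArg C (by ext i; fin_cases i <;> rfl)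

lemma marginWm_eq_insertNth (C : (Fin 3 → ℝ) → ℝ) :
    marginWm C = fun p => C ((1 : Fin 3).insertNth (1 : ℝ) p) := by
  funext p
  exact congrArg C (by ext i; fin_cases i <;> rfl)

lemma marginMm_eq_insertNth (C : (Fin 3 → ℝ) → ℝ) :
    marginMm C = fun p => C ((0 : Fin 3).insertNth (1 : ℝ) p) := by
  funext p
  exact congrArg C (by ext i; fin_cases i <;> rfl)

section SpearmanRho

variable {Ω : Type*} [MeasurableSpace Ω] {P : Measure Ω}
  {V : ℝ≥0 → Ω → ℝ} {C : (Fin 3 → ℝ) → ℝ}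

lemma IsRegularBrownian.spearmanRho_marginWM (hV : IsRegularBrownian V P)
    (hC : IsCopulaOf C (wienerTriple V 1) P) :
    spearmanRho (marginWM C) = 2 - 6 / Real.pi * Real.arccos (√6 / 3) := by
  have := hV.isProbabilityMeasure
  rw [marginWM_eq_insertNth, hC.spearmanRho_insertNth_one (hV.measurable_wienerTriple 1)
    (hV.nullSingletonClass_map_wienerTriple one_ne_zero)]
  change 12 * meanJointCdf P (V 1) (runningMax V 1) - 3 = _
  rw [hV.meanJointCdf_eval_runningMax]
  ring

lemma IsRegularBrownian.spearmanRho_marginWm (hV : IsRegularBrownian V P)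
    (hC : IsCopulaOf C (wienerTriple V 1) P) :
    spearmanRho (marginWm C) = 2 - 6 / Real.pi * Real.arccos (√6 / 3) := by
  have := hV.isProbabilityMeasure
  rw [marginWm_eq_insertNth, hC.spearmanRho_insertNth_one (hV.measurable_wienerTriple 1)
    (hV.nullSingletonClass_map_wienerTriple one_ne_zero)]
  change 12 * meanJointCdf P (V 1) (runningMin V 1) - 3 = _
  rw [hV.meanJointCdf_eval_runningMin]
  ring

lemma IsRegularBrownian.spearmanRho_marginMm (hV : IsRegularBrownian V P)
    (hC : IsCopulaOf C (wienerTriple V 1) P) :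
    spearmanRho (marginMm C)
      = 24 / Real.pi * (∑' n : ℕ, (-1 : ℝ) ^ n * arccosBracket n) - 3 := by
  have := hV.isProbabilityMeasure
  rw [marginMm_eq_insertNth, hC.spearmanRho_insertNth_one (hV.measurable_wienerTriple 1)
    (hV.nullSingletonClass_map_wienerTriple one_ne_zero)]
  change 12 * meanJointCdf P (runningMax V 1) (runningMin V 1) - 3 = _
  rw [hV.meanJointCdf_runningMax_runningMin, hasSum_arccosBracket.tsum_eq]
  field_simp
  ring

end SpearmanRho

theorem proposition1 {Ω : Type*} [MeasurableSpace Ω] (P : Measure Ω) [IsProbabilityMeasure P]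
    (W : ℝ≥0 → Ω → ℝ) (hW : IsBrownianReal W P) :
    -- the copula of the triple exists and does not depend on the time
    (∃ C : (Fin 3 → ℝ) → ℝ, ∀ t : ℝ≥0, 0 < t → IsCopulaOf C (wienerTriple W t) P) ∧
    ∀ C : (Fin 3 → ℝ) → ℝ, (∃ t : ℝ≥0, 0 < t ∧ IsCopulaOf C (wienerTriple W t) P) →
      spearmanRho (marginWM C) = 2 - 6 / Real.pi * Real.arccos (√6 / 3) ∧
      spearmanRho (marginWm C) = 2 - 6 / Real.pi * Real.arccos (√6 / 3) ∧
      |2 - 6 / Real.pi * Real.arccos (√6 / 3) - 0.8245| < 0.00005 ∧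
      Summable (fun n : ℕ => (-1 : ℝ) ^ n * arccosBracket n) ∧
      spearmanRho (marginMm C) =
        24 / Real.pi * (∑' n : ℕ, (-1 : ℝ) ^ n * arccosBracket n) - 3 ∧
      |spearmanRho (marginMm C) - 0.80649| < 0.000005 := by
  obtain ⟨V, hV, -⟩ := exists_isRegularBrownian hW
  refine ⟨?_, ?_⟩
  · obtain ⟨C, hC⟩ := hV.exists_isCopulaOf one_ne_zero
    exact ⟨C, fun t ht => (isCopulaOf_wienerTriple_iff hW hV ht).2 hC⟩
  · rintro C ⟨t, ht, hCt⟩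
    have hC : IsCopulaOf C (wienerTriple V 1) P := (isCopulaOf_wienerTriple_iff hW hV ht).1 hCt
    have hMm := hV.spearmanRho_marginMm hC
    exact ⟨hV.spearmanRho_marginWM hC, hV.spearmanRho_marginWm hC,
      abs_two_sub_arccos_sub_value_lt, hasSum_arccosBracket.summable, hMm,
      hMm ▸ abs_tsum_arccosBracket_sub_value_lt⟩
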